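/- **Setting.** Let $L\ge 0$, let $E_0,\dots,E_L$ be measurable spaces with $\mathcal Z:=E_L$ standard Borel, and let $K_l$ ($0\le l<L$) be Markov kernels from $E_l$ to $E_{l+1}$. An element $x\in E_l$ is a node of depth $l$ and stands for the distribution $K_l(x)$ of its children (if nodes are themselves distributions, $E_l$ is the space of probability measures on $E_{l+1}$ and $K_l(x)=x$). Fix a root $r\in E_0$ (so $D=K_0(r)$ is the meta-distribution) and branching numbers $n_1,\dots,n_L\ge 1$, and put $N_l=n_1\cdots n_l$. The dataset is the random tree $\mu=(\mu_l^{i_{1:l}})$, in which, given the nodes of depth at most $l-1$, the nodes $\mu_l^{i_{1:l}}$, $1\le i_k\le n_k$, are independent with $\mu_l^{i_{1:l}}\sim K_{l-1}(\mu_{l-1}^{i_{1:l-1}})$, $\mu_0=r$. Let $\mathcal W$ be a standard Borel space and let the algorithm $P_{W|\mu}$ be any Markov kernel from whole trees to $\mathcal W$. For measurable $\ell:\mathcal W\times\mathcal Z\to\mathbb R$ put $$\mathrm{gen}=\mathbb E_{\mu,W}\Big[\mathbb E_{z}[\ell(W,z)]-\frac1{N_L}\sum_{i_{1:L}}\ell(W,\mu_L^{i_{1:L}})\Big],$$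 where $z$ is an independent leaf, drawn through the chain $K_0(r),K_1,\dots,K_{L-1}$. **Supersample.** For every position $i_{1:l}$, $1\le l\le L$, there is an independent fair decision $U_l^{i_{1:l}}\in\{1,2\}$ and a pair $\tilde\mu_l^{i_{1:l}}=(\mu_{l,1}^{i_{1:l}},\mu_{l,2}^{i_{1:l}})$ of copies that are i.i.d. from the selected parent; the copy with label $U_l^{i_{1:l}}$ is the selected node, the other one is the ghost node, and below the ghost node an independent tree with the same branching is sampled in the same way. The hypothesis $W$ is learned from the tree of selected nodes. Let $\tilde\mu_L^{i_{1:l}}$ be the pair formed by all the leaves below $\mu_{l,1}^{i_{1:l}}$ and all the leaves below $\mu_{l,2}^{i_{1:l}}$, listed in the order of the labels $1,2$ (so one component consists of the selected leaves $\mu_L^{i_{1:l}}$ and the other one of the ghost leaves $\bar\mu_L^{i_{1:l}}$; which is which is told by $U_l^{i_{1:l}}$). For a node $\nu=(l,i_{1:l})$ write $U,X,Y$ for $U_l^{i_{1:l}},\tilde\mu_l^{i_{1:l}},\tilde\mu_L^{i_{1:l}}$. For $c:\mathcal W\times\mathcal W\to[0,\infty]$ let $\mathbb W_c(P,Q)=\inf_\pi\int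 c\,d\pi$ over all couplings $\pi$ of $P,Q$, and let $I(A;B|C)=\mathbb E_{c\sim C}[I(A;B|C=c)]$ with $I(A;B|C=c)=D_{KL}(P_{AB|C=c}\|P_{A|C=c}\otimes P_{B|C=c})$. **Statement.** 1. Let $\rho$ be a measurable metric on $\mathcal W$, let $\ell$ be $\Lambda$-Lipschitz in its first argument with respect to $\rho$ for every $z\in\mathcal Z$, and let $\ell(W,z)$ (with $z$ an independent leaf as above) and $\ell(W,\mu_L^{i_{1:L}})$ be integrable. Then $$\mathrm{gen}\le 2\Lambda\sum_{l=1}^L\frac1{N_l}\sum_{i_{1:l}}\mathbb E\,\mathbb W_\rho\big(P_{W|\tilde\mu_L^{i_{1:l}},U_l^{i_{1:l}}},P_{W|\tilde\mu_L^{i_{1:l}}}\big).$$ 2. If $0\le\ell\le1$, then $\mathrm{gen}\le 2\sum_{l}\frac1{N_l}\sum_{i_{1:l}}\mathbb E\,\mathbb W_\delta(P_{W|Y,U},P_{W|Y})$, where $\delta$ is the discrete metric, and for every node $$2\,\mathbb E\,\mathbb W_\delta(P_{W|Y,U},P_{W|Y})\le\mathbb E_{y\sim Y}\sqrt{2I(W;U|Y=y)}\le\sqrt{2I(W;U|Y)}.$$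 3. For every node at which the Markov chain $X-(Y,U)-W$ holds, $I(W;U|X)\le I(W;U|Y)<\infty$, and the gap is exactly $$I(W;U|Y)-I(W;U|X)=I(U;Y|X,W).$$ 4. Consequently, if this Markov chain holds at every node, the relaxed bound from 1 is looser than the conditional-mutual-information bound that conditions on the pair of nodes only: $$\sum_{l=1}^L\frac1{N_l}\sum_{i_{1:l}}\mathbb E_{x\sim X}\sqrt{2I(W;U|X=x)}\le\sum_{l=1}^L\frac1{N_l}\sum_{i_{1:l}}\sqrt{2I(W;U|X)}\le\sum_{l=1}^L\frac1{N_l}\sum_{i_{1:l}}\sqrt{2I(W;U|Y)}.$$ 5. If the algorithm uses the leaves of the tree only, the Markov chain $X-(Y,U)-W$ holds at all nodes of the first level and of the last level (hence at every node if $L\le2$). -/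

import Mathlib

open MeasureTheory ProbabilityTheory
open scoped NNReal ENNReal

universe u v

/-! ### Indices of tree nodes -/

/-- Positions of the nodes of depth `l` in a rooted tree in which every node of depth `k` has its
children indexed by `C k`: such a position is the sequence of the `l` choices made along the path
from the root. The root is the only position of depth `0`. -/
abbrev NodeIndex (C : ℕ → Type) (l : ℕ) : Type := ∀ k : Fin l, C k

/-- The ancestor at depth `l` of a position of depth `m ≥ l`. -/
def NodeIndex.ancestor {C : ℕ → Type} {l m : ℕ} (h : l ≤ m) (j : NodeIndex C m) : NodeIndex C l :=
  fun k => j ⟨k, k.2.trans_le h⟩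

/-- Children of a node in a tree with `n k` children for every node of depth `k`. -/
abbrev Branch (n : ℕ → ℕ) : ℕ → Type := fun k => Fin (n k)

/-- Children in the supersample: every child comes in two copies, labelled by `Bool`. -/
abbrev Doubled (n : ℕ → ℕ) : ℕ → Type := fun k => Fin (n k) × Bool

/-- The number `N_l` of nodes of depth `l`. -/
def levelSize (n : ℕ → ℕ) (l : ℕ) : ℕ := ∏ k ∈ Finset.range l, n k

/-! ### Hierarchical sampling

A node of depth `l` takes values in the space `E l`, and a node with value `x : E l` stands for the
distribution `K l x` on `E (l + 1)` from which its children are drawn (if nodes are themselves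
distributions, then `E l` is the space of probability measures on `E (l + 1)` and `K l x = x`). The
meta-distribution is `K 0 root`, and the data space is `E L`. -/

/-- The values of all the nodes of depth `0, …, L`. -/
abbrev SampleTree (C : ℕ → Type) (E : ℕ → Type u) (L : ℕ) : Type u :=
  ∀ l : Fin (L + 1), NodeIndex C l → E l

/-- The leaves (data points) of a tree. -/
def SampleTree.leaves {C : ℕ → Type} {E : ℕ → Type u} {L : ℕ} (T : SampleTree C E L) :
    NodeIndex C L → E L :=
  T (Fin.last L)

/-- The finite product of Markov kernels with a common source: given `x`, the coordinates are
independent and the `i`-th one has law `κ i x`. -/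
noncomputable def productKernel {ι : Type} [Fintype ι] {α : Type u} {β : Type v}
    [MeasurableSpace α] [MeasurableSpace β] (κ : ι → Kernel α β) [∀ i, IsMarkovKernel (κ i)] :
    Kernel α (ι → β) where
  toFun x := Measure.pi fun i => κ i x
  measurable' := by
    refine Measurable.measure_of_isPiSystem_of_isProbabilityMeasure generateFrom_pi.symm
      isPiSystem_pi ?_
    rintro _ ⟨s, hs, rfl⟩
    simp only [Measure.pi_pi]
    exact Finset.measurable_prod _ fun i _ =>
      Kernel.measurable_coe (κ i) (hs i (Set.mem_univ i))

instance {ι : Type} [Fintype ι] {α : Type u} {β : Type v}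
    [MeasurableSpace α] [MeasurableSpace β] (κ : ι → Kernel α β) [∀ i, IsMarkovKernel (κ i)] :
    IsMarkovKernel (productKernel κ) :=
  ⟨fun x => inferInstanceAs (IsProbabilityMeasure (Measure.pi fun i => κ i x))⟩

section Sampling

variable {E : ℕ → Type u} [∀ l, MeasurableSpace (E l)]

/-- Given the nodes of depth at most `L`, the nodes of depth `L + 1` are independent, each one
drawn from (the distribution represented by) its parent. -/
noncomputable def childrenKernel (C : ℕ → Type) [∀ k, Fintype (C k)]
    (K : ∀ l, Kernel (E l) (E (l + 1))) [∀ l, IsMarkovKernel (K l)] (L : ℕ) :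
    Kernel (SampleTree C E L) (NodeIndex C (L + 1) → E (L + 1)) :=
  productKernel fun p : NodeIndex C (L + 1) =>
    (K L).comap (fun T : SampleTree C E L => T.leaves (p.ancestor L.le_succ))
      (by unfold SampleTree.leaves; fun_prop)

instance (C : ℕ → Type) [∀ k, Fintype (C k)]
    (K : ∀ l, Kernel (E l) (E (l + 1))) [∀ l, IsMarkovKernel (K l)] (L : ℕ) :
    IsMarkovKernel (childrenKernel C K L) := by
  unfold childrenKernel; infer_instance

/-- Add one level to a tree. -/
def SampleTree.extend {C : ℕ → Type} {L : ℕ}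
    (p : SampleTree C E L × (NodeIndex C (L + 1) → E (L + 1))) : SampleTree C E (L + 1) :=
  Fin.snoc (α := fun l : Fin (L + 2) => NodeIndex C l → E l) p.1 p.2

theorem SampleTree.measurable_extend {C : ℕ → Type} {L : ℕ} :
    Measurable (SampleTree.extend (C := C) (E := E) (L := L)) := by
  refine measurable_pi_iff.2 fun l => ?_
  induction l using Fin.lastCases with
  | last =>
    have h : (fun p : SampleTree C E L × (NodeIndex C (L + 1) → E (L + 1)) =>
        SampleTree.extend p (Fin.last (L + 1))) = fun p => p.2 := by
      funext p; exact Fin.snoc_last (α := fun l : Fin (L + 2) => NodeIndex C l → E l) p.2 p.1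
    rw [h]; exact measurable_snd
  | cast l =>
    have h : (fun p : SampleTree C E L × (NodeIndex C (L + 1) → E (L + 1)) =>
        SampleTree.extend p l.castSucc) = fun p => p.1 l := by
      funext p
      exact Fin.snoc_castSucc (α := fun l : Fin (L + 2) => NodeIndex C l → E l) p.2 p.1 l
    rw [h]; exact (measurable_pi_apply l).comp measurable_fst

/-- The law of the hierarchical sample of depth `L` with the given root. -/
noncomputable def treeLaw (C : ℕ → Type) [∀ k, Fintype (C k)] (root : E 0)
    (K : ∀ l, Kernel (E l) (E (l + 1))) [∀ l, IsMarkovKernel (K l)] :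
    (L : ℕ) → Measure (SampleTree C E L)
  | 0 => Measure.dirac
      (Fin.cons (α := fun l : Fin 1 => NodeIndex C l → E l) (fun _ => root) fun i => i.elim0)
  | L + 1 => (treeLaw C root K L ⊗ₘ childrenKernel C K L).map SampleTree.extend

instance (C : ℕ → Type) [∀ k, Fintype (C k)] (root : E 0)
    (K : ∀ l, Kernel (E l) (E (l + 1))) [∀ l, IsMarkovKernel (K l)] (L : ℕ) :
    IsProbabilityMeasure (treeLaw C root K L) := by
  induction L with
  | zero => unfold treeLaw; infer_instance
  | succ L ih =>
    unfold treeLaw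
    exact Measure.isProbabilityMeasure_map SampleTree.measurable_extend.aemeasurable

/-- The law of a single node of depth `l`, drawn through the chain of its ancestors. -/
noncomputable def chainLaw (root : E 0) (K : ∀ l, Kernel (E l) (E (l + 1))) :
    (l : ℕ) → Measure (E l)
  | 0 => Measure.dirac root
  | l + 1 => K l ∘ₘ chainLaw root K l

end Sampling

/-! ### Generalization error -/

section Risk

variable {E : ℕ → Type u} [∀ l, MeasurableSpace (E l)] {𝒲 : Type v} {L : ℕ} {n : ℕ → ℕ}

/-- Population risk of the hypothesis `w`. -/
noncomputable def populationRisk (root : E 0) (K : ∀ l, Kernel (E l) (E (l + 1)))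
    (ℓ : 𝒲 → E L → ℝ) (w : 𝒲) : ℝ :=
  ∫ z, ℓ w z ∂chainLaw root K L

/-- Empirical risk of the hypothesis `w` on the data points of the tree `T`. -/
noncomputable def empiricalRisk (ℓ : 𝒲 → E L → ℝ) (w : 𝒲) (T : SampleTree (Branch n) E L) : ℝ :=
  (levelSize n L : ℝ)⁻¹ * ∑ j : NodeIndex (Branch n) L, ℓ w (T.leaves j)

/-- Expected generalization error of the learning algorithm `A`, a kernel from whole trees to
hypotheses. -/
noncomputable def genError [MeasurableSpace 𝒲] (root : E 0) (K : ∀ l, Kernel (E l) (E (l + 1)))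
    [∀ l, IsMarkovKernel (K l)] (A : Kernel (SampleTree (Branch n) E L) 𝒲)
    (ℓ : 𝒲 → E L → ℝ) : ℝ :=
  ∫ p, (populationRisk root K ℓ p.2 - empiricalRisk ℓ p.2 p.1)
    ∂(treeLaw (Branch n) root K L ⊗ₘ A)

/-- The algorithm has access to the leaves of the tree only. -/
def UsesOnlyLeaves [MeasurableSpace 𝒲] (A : Kernel (SampleTree (Branch n) E L) 𝒲) : Prop :=
  ∃ A' : Kernel (NodeIndex (Branch n) L → E L) 𝒲, ∀ T, A T = A' T.leaves

end Risk

/-! ### Supersample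

The two copies of every node are drawn from the common parent, together with the whole tree below
each copy: this is a hierarchical sample in which the children of a node of depth `k` are indexed by
`Fin (n k) × Bool`. Independently, one fair decision variable is drawn for every node of the
original tree, and following the decisions yields the selected tree. The ghost copy of a node and
the ghost tree below it are reached by reversing the decision at that node. -/

section Supersample

/-- The nodes of depth `1, …, L`; the node `⟨l, i⟩` has depth `l + 1`. -/
abbrev ProperNode (n : ℕ → ℕ) (L : ℕ) : Type := Σ l : Fin L, NodeIndex (Branch n) (l + 1)

/-- One binary decision per node. -/
abbrev Decisions (n : ℕ → ℕ) (L : ℕ) : Type := ProperNode n L → Bool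

variable {n : ℕ → ℕ} {L : ℕ} {E : ℕ → Type u} {𝒲 : Type v}

/-- The position in the supersample of the selected copy of the node at position `j`. -/
def selectedIndex (U : Decisions n L) {m : ℕ} (hm : m ≤ L) (j : NodeIndex (Branch n) m) :
    NodeIndex (Doubled n) m :=
  fun k => (j k, U ⟨⟨k, k.2.trans_le hm⟩, j.ancestor k.2⟩)

/-- The selected tree. -/
def selectedTree (U : Decisions n L) (T : SampleTree (Doubled n) E L) :
    SampleTree (Branch n) E L :=
  fun l j => T l (selectedIndex U (Nat.lt_succ_iff.1 l.2) j)

/-- The supersample, the decisions and the output hypothesis. -/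
abbrev SuperSpace (n : ℕ → ℕ) (L : ℕ) (E : ℕ → Type u) (𝒲 : Type v) : Type (max u v) :=
  (SampleTree (Doubled n) E L × Decisions n L) × 𝒲

/-- The output hypothesis `W`. -/
def hypothesis (ω : SuperSpace n L E 𝒲) : 𝒲 := ω.2

/-- The decision variable of the node `ν`. -/
def decision (ν : ProperNode n L) (ω : SuperSpace n L E 𝒲) : Bool := ω.1.2 ν

/-- The two copies of the node `ν` in the supersample, in the order of their labels (so that the
selected one is at the label `decision ν ω`). -/
def nodePair (ν : ProperNode n L) (ω : SuperSpace n L E 𝒲) : Bool → E (ν.1 + 1) :=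
  fun b => selectedTree (Function.update ω.1.2 ν b) ω.1.1 ν.1.succ ν.2

/-- The positions of the leaves below the node `ν`. -/
abbrev LeafBelow (ν : ProperNode n L) : Type :=
  {j : NodeIndex (Branch n) L // j.ancestor ν.1.2 = ν.2}

/-- The leaves of the trees below the two copies of the node `ν`, in the order of the labels of
these copies. -/
def leafPair (ν : ProperNode n L) (ω : SuperSpace n L E 𝒲) : Bool → LeafBelow ν → E L :=
  fun b j => (selectedTree (Function.update ω.1.2 ν b) ω.1.1).leaves j.1

variable [∀ l, MeasurableSpace (E l)] [MeasurableSpace 𝒲]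

theorem measurable_selectedTree :
    Measurable fun p : SampleTree (Doubled n) E L × Decisions n L => selectedTree p.2 p.1 := by
  refine measurable_from_prod_countable_left fun U => ?_
  exact measurable_pi_iff.2 fun l => measurable_pi_iff.2 fun j =>
    (measurable_pi_apply (selectedIndex U (Nat.lt_succ_iff.1 l.2) j)).comp (measurable_pi_apply l)

/-- The joint law of the supersample, the decisions (fair, independent of each other and of the
supersample) and the hypothesis learned from the selected tree. -/
noncomputable def superLaw (root : E 0) (K : ∀ l, Kernel (E l) (E (l + 1)))
    [∀ l, IsMarkovKernel (K l)] (A : Kernel (SampleTree (Branch n) E L) 𝒲) :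
    Measure (SuperSpace n L E 𝒲) :=
  ((treeLaw (Doubled n) root K L).prod
    (Measure.pi fun _ : ProperNode n L => (PMF.uniformOfFintype Bool).toMeasure)) ⊗ₘ
    A.comap (fun p => selectedTree p.2 p.1) measurable_selectedTree

instance (root : E 0) (K : ∀ l, Kernel (E l) (E (l + 1)))
    [∀ l, IsMarkovKernel (K l)] (A : Kernel (SampleTree (Branch n) E L) 𝒲) [IsMarkovKernel A] :
    IsProbabilityMeasure (superLaw root K A) := by
  unfold superLaw; infer_instance

end Supersample

/-! ### Wasserstein distance, conditional mutual information, Markov chains -/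

/-- The optimal transport cost between `P` and `Q` for the cost function `c`; it is the Wasserstein
distance of order one if `c` is a metric. -/
noncomputable def transportCost {𝒲 : Type v} [MeasurableSpace 𝒲] (c : 𝒲 → 𝒲 → ℝ≥0∞)
    (P Q : Measure 𝒲) : ℝ≥0∞ :=
  ⨅ (π : Measure (𝒲 × 𝒲)) (_ : π.fst = P ∧ π.snd = Q), ∫⁻ p, c p.1 p.2 ∂π

open Classical in
/-- The discrete metric. -/
noncomputable def discreteDist {𝒲 : Type v} (x y : 𝒲) : ℝ≥0∞ := if x = y then 0 else 1

section Information

variable {Ω α β γ : Type*} [MeasurableSpace Ω] [MeasurableSpace α] [MeasurableSpace β]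
  [MeasurableSpace γ]

/-- The mutual information of `X` and `Y` under their conditional law given `Z = z`. -/
noncomputable def condMutualInfoAt [StandardBorelSpace α] [Nonempty α] [StandardBorelSpace β]
    [Nonempty β] (X : Ω → α) (Y : Ω → β) (Z : Ω → γ) (P : Measure Ω) [IsFiniteMeasure P]
    (z : γ) : ℝ≥0∞ :=
  InformationTheory.klDiv (condDistrib (fun ω => (X ω, Y ω)) Z P z)
    ((condDistrib X Z P z).prod (condDistrib Y Z P z))

/-- The conditional mutual information `I(X; Y | Z)`. -/
noncomputable def condMutualInfo [StandardBorelSpace α] [Nonempty α] [StandardBorelSpace β]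
    [Nonempty β] (X : Ω → α) (Y : Ω → β) (Z : Ω → γ) (P : Measure Ω) [IsFiniteMeasure P] : ℝ≥0∞ :=
  ∫⁻ z, condMutualInfoAt X Y Z P z ∂(P.map Z)

/-- `X - V - W` is a Markov chain: the conditional laws of `W` given `(X, V)` and given `V`
agree. -/
def IsMarkovChain [StandardBorelSpace γ] [Nonempty γ] (X : Ω → α) (V : Ω → β) (W : Ω → γ)
    (P : Measure Ω) [IsFiniteMeasure P] : Prop :=
  ∀ᵐ ω ∂P, condDistrib W (fun ω => (X ω, V ω)) P (X ω, V ω) = condDistrib W V P (V ω)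

end Information

section Bounds

variable {n : ℕ → ℕ} {L : ℕ} {E : ℕ → Type u} [∀ l, MeasurableSpace (E l)] {𝒲 : Type v}
  [MeasurableSpace 𝒲]

/-- For a quantity attached to the nodes: the sum over the levels `1, …, L` of its mean over the
nodes of the level. -/
noncomputable def sumOfLevelMeans (f : ProperNode n L → ℝ≥0∞) : ℝ≥0∞ :=
  ∑ l : Fin L, (levelSize n (l + 1) : ℝ≥0∞)⁻¹ * ∑ i : NodeIndex (Branch n) (l + 1), f ⟨l, i⟩

variable [StandardBorelSpace 𝒲] [Nonempty 𝒲] (P : Measure (SuperSpace n L E 𝒲))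
  [IsFiniteMeasure P]

/-- The expected transport cost between the law of `W` given the leaves below both copies of `ν`
and the decision at `ν`, and the law of `W` given these leaves only. -/
noncomputable def leafTransport (c : 𝒲 → 𝒲 → ℝ≥0∞) (ν : ProperNode n L) : ℝ≥0∞ :=
  ∫⁻ ω, transportCost c
    (condDistrib hypothesis (fun ω => (leafPair ν ω, decision ν ω)) P
      (leafPair ν ω, decision ν ω))
    (condDistrib hypothesis (leafPair ν) P (leafPair ν ω)) ∂P

/-- `I(W; U_ν | leaves below both copies of ν)`. -/
noncomputable def leafInfo (ν : ProperNode n L) : ℝ≥0∞ :=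
  condMutualInfo hypothesis (decision ν) (leafPair ν) P

/-- `I(W; U_ν | both copies of ν)`. -/
noncomputable def nodeInfo (ν : ProperNode n L) : ℝ≥0∞ :=
  condMutualInfo hypothesis (decision ν) (nodePair ν) P

/-- The expectation of `√(2 I(W; U_ν | leaves))`, with the information at a realization of the
leaves below both copies of `ν`. -/
noncomputable def leafSqrtInfo (ν : ProperNode n L) : ℝ≥0∞ :=
  ∫⁻ ω, (2 * condMutualInfoAt hypothesis (decision ν) (leafPair ν) P (leafPair ν ω)) ^ (1 / 2 : ℝ)
    ∂P

/-- The expectation of `√(2 I(W; U_ν | nodes))`, with the information at a realization of the two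
copies of `ν`. -/
noncomputable def nodeSqrtInfo (ν : ProperNode n L) : ℝ≥0∞ :=
  ∫⁻ ω, (2 * condMutualInfoAt hypothesis (decision ν) (nodePair ν) P (nodePair ν ω)) ^ (1 / 2 : ℝ)
    ∂P

/-- The Markov chain (both copies of `ν`) - (leaves below both copies, decision) - `W`. -/
def NodeMarkov (ν : ProperNode n L) : Prop :=
  IsMarkovChain (nodePair ν) (fun ω => (leafPair ν ω, decision ν ω)) hypothesis P

end Bounds

set_option linter.unusedSectionVars false

/-! ### Products of measures -/

section Pi

variable {ι ι' : Type} [Fintype ι] [Fintype ι'] {β : Type*} [MeasurableSpace β]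

/-! The generalization bound rests on one symmetrization, at the first level of the tree. Fix a leaf
position and its first-level ancestor ν. The ghost leaf below the unselected copy of ν is
independent of the selected tree, hence of W, and has the law of a fresh leaf
(`treeLaw_map_selectedTree_ghost`). So gen is the average over leaf positions of E[ℓ(W, ghost leaf)
− ℓ(W, selected leaf)]. With Y the leaf pair of ν, this difference is ± G(Y, W): the sign is read
off U, and G is the difference of the losses at the two labelled leaves. As U is fair given Y, the
mean vanishes once W is redrawn from P_{W|Y}; what remains is the change from P_{W|Y,U} to P_{W|Y},
paid for by the transport cost (`IsFairGiven.ofReal_integral_le`). Averaging over leaves gives the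
level-one mean, and deeper levels only add nonnegative terms. For L = 0 the error is zero.

Every information quantity reduces to entropies of a binary variable: I(W;U|Z=z) = h(P(U|z)) − E
h(P(U|z,W)), which is always finite (`klDiv_compProd_bool`, `condMutualInfo_eq`). For fair U the
first entropy is log 2, and by Bayes P_{W|z,U=b} has density 2 P(U=b|z,w) with respect to P_{W|z}. A
maximal coupling bounds the discrete transport cost by total variation; the binary Pinsker
inequality h(p) ≤ log 2 − 2(p − 1/2)² and Cauchy–Schwarz then bound it by the information
(`two_mul_transportCost_le`).

For the comparison, fairness of U given (X,Y) and the chain X − (Y,U) − W make U independent of X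
given (Y,W), so H(U|X,Y,W) = H(U|Y,W) (`IsMarkovChain.condEntropy_eq`). Subtracting log 2 − H(U|X,W)
from log 2 − H(U|Y,W) leaves H(U|X,W) − H(U|X,W,Y) = I(U;Y|X,W).

At the last level X is part of Y, so the chain is automatic. At the first level W is made from (Y,U)
and the leaves outside ν, which are independent of (X,Y,U). This independence and that of the ghost
leaf both come from `treeLaw_prod_map_merge`: grafting branches at the root from one sample onto an
independent one preserves the law. -/

theorem measurable_merge (p : ι → Prop) [DecidablePred p] :
    Measurable fun (x : (ι → β) × (ι → β)) i => if p i then x.1 i else x.2 i := by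
  refine measurable_pi_iff.2 fun i => ?_
  by_cases h : p i
  · simp only [h, if_true]; fun_prop
  · simp only [h, if_false]; fun_prop

/-- Each coordinate is taken from exactly one of two independent families, so independence survives.
With μ = ν this is resampling of some coordinates; it is the one-level case of merging trees. -/
theorem pi_prod_map_merge (p : ι → Prop) [DecidablePred p] (μ ν : ι → Measure β)
    [∀ i, IsProbabilityMeasure (μ i)] [∀ i, IsProbabilityMeasure (ν i)] :
    ((Measure.pi μ).prod (Measure.pi ν)).map (fun x i => if p i then x.1 i else x.2 i) =
      Measure.pi fun i => if p i then μ i else ν i := by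
  classical
  have hprob : ∀ i, IsProbabilityMeasure (if p i then μ i else ν i) := fun i => by
    split_ifs <;> infer_instance
  symm
  refine Measure.pi_eq fun s hs => ?_
  rw [Measure.map_apply (measurable_merge p) (MeasurableSet.univ_pi hs)]
  have : (fun (x : (ι → β) × (ι → β)) i => if p i then x.1 i else x.2 i) ⁻¹' Set.univ.pi s =
      (Set.univ.pi fun i => if p i then s i else Set.univ) ×ˢ
        (Set.univ.pi fun i => if p i then Set.univ else s i) := by
    ext x
    simp only [Set.mem_preimage, Set.mem_univ_pi, Set.mem_prod, ← forall_and]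
    refine forall_congr' fun i => ?_
    by_cases h : p i <;> simp [h]
  rw [this, Measure.prod_prod, Measure.pi_pi, Measure.pi_pi, ← Finset.prod_mul_distrib]
  refine Finset.prod_congr rfl fun i _ => ?_
  by_cases h : p i <;> simp [h]

theorem pi_map_comp_injective {f : ι' → ι} (hf : Function.Injective f) (μ : ι → Measure β)
    [∀ i, IsProbabilityMeasure (μ i)] :
    (Measure.pi μ).map (fun x i => x (f i)) = Measure.pi fun i => μ (f i) := by
  have h : iIndepFun (fun i (x : ι → β) => x (f i)) (Measure.pi μ) :=
    (iIndepFun_pi (μ := μ) (X := fun _ => id) fun _ => aemeasurable_id).precomp hf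
  rw [iIndepFun_iff_map_fun_eq_pi_map fun i => (measurable_pi_apply (f i)).aemeasurable] at h
  refine h.trans ?_
  congr 1
  funext i
  exact (measurePreserving_eval μ (f i)).map_eq

end Pi

/-! ### Change of variables in composition-products -/

section CompProd

variable {α α' β β' : Type*} [MeasurableSpace α] [MeasurableSpace α'] [MeasurableSpace β]
  [MeasurableSpace β']

/-- The tool for inductions on the depth: an operation that intertwines the sampling of the next
level commutes with adding that level. -/
theorem compProd_map_prodMap (μ : Measure α) [SFinite μ] (κ : Kernel α β) [IsSFiniteKernel κ]
    {r : α → α'} (hr : Measurable r) {s : β → β'} (hs : Measurable s) (κ' : Kernel α' β')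
    [IsSFiniteKernel κ'] (h : ∀ a, (κ a).map s = κ' (r a)) :
    (μ ⊗ₘ κ).map (Prod.map r s) = μ.map r ⊗ₘ κ' := by
  refine Measure.ext_of_lintegral _ fun f hf => ?_
  rw [lintegral_map hf (by fun_prop), Measure.lintegral_compProd (by fun_prop),
    Measure.lintegral_compProd hf, lintegral_map hf.lintegral_kernel_prod_right' hr]
  refine lintegral_congr fun a => ?_
  rw [← h a, lintegral_map (by fun_prop) hs]
  rfl

theorem compProd_prod_compProd (μ : Measure α) [SFinite μ] (κ : Kernel α β) [IsSFiniteKernel κ]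
    (μ' : Measure α') [SFinite μ'] (κ' : Kernel α' β') [IsSFiniteKernel κ'] :
    (μ ⊗ₘ κ).prod (μ' ⊗ₘ κ') = ((μ.prod μ') ⊗ₘ (κ ∥ₖ κ')).map
      (fun q => ((q.1.1, q.2.1), (q.1.2, q.2.2))) := by
  refine Measure.ext_of_lintegral _ fun f hf => ?_
  rw [lintegral_map hf (by fun_prop), Measure.lintegral_compProd (by fun_prop),
    lintegral_prod _ hf.aemeasurable, Measure.lintegral_compProd hf.lintegral_prod_right',
    lintegral_prod _ (Measurable.aemeasurable (Measurable.lintegral_kernel_prod_right'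
      (f := fun q : (α × α') × (β × β') => f ((q.1.1, q.2.1), (q.1.2, q.2.2))) (by fun_prop)))]
  refine lintegral_congr fun a => ?_
  simp_rw [Measure.lintegral_compProd (μ := μ') (κ := κ') (f := fun q => f (_, q))
    (hf.comp measurable_prodMk_left)]
  rw [lintegral_lintegral_swap]
  · refine lintegral_congr fun a' => ?_
    rw [Kernel.lintegral_parallelComp]
    fun_prop
  · refine Measurable.aemeasurable ?_
    exact Measurable.lintegral_kernel_prod_right' (κ := κ'.comap Prod.snd measurable_snd)
      (f := fun q : (β × α') × β' => f ((a, q.1.1), (q.1.2, q.2))) (by fun_prop)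

theorem dirac_compProd (a : α) (κ : Kernel α β) [IsSFiniteKernel κ] :
    Measure.dirac a ⊗ₘ κ = (κ a).map (Prod.mk a) := by
  refine Measure.ext_of_lintegral _ fun f hf => ?_
  rw [Measure.lintegral_compProd hf, lintegral_map hf (by fun_prop),
    lintegral_dirac' _ hf.lintegral_kernel_prod_right']

end CompProd

/-! ### Laws of hierarchical samples -/

section TreeLaw

variable {C C' : ℕ → Type} [∀ k, Fintype (C k)] [∀ k, Fintype (C' k)] {E : ℕ → Type u}
  [∀ l, MeasurableSpace (E l)] (root : E 0) (K : ∀ l, Kernel (E l) (E (l + 1)))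
  [∀ l, IsMarkovKernel (K l)]

theorem SampleTree.extend_last {L : ℕ}
    (p : SampleTree C E L × (NodeIndex C (L + 1) → E (L + 1))) :
    SampleTree.extend p (Fin.last (L + 1)) = p.2 :=
  Fin.snoc_last (α := fun l : Fin (L + 2) => NodeIndex C l → E l) p.2 p.1

theorem SampleTree.extend_castSucc {L : ℕ}
    (p : SampleTree C E L × (NodeIndex C (L + 1) → E (L + 1))) (l : Fin (L + 1)) :
    SampleTree.extend p l.castSucc = p.1 l :=
  Fin.snoc_castSucc (α := fun l : Fin (L + 2) => NodeIndex C l → E l) p.2 p.1 l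

theorem childrenKernel_apply (L : ℕ) (T : SampleTree C E L) :
    childrenKernel C K L T =
      Measure.pi fun p : NodeIndex C (L + 1) => K L (T.leaves (p.ancestor L.le_succ)) := rfl

theorem measurable_leaves {L : ℕ} : Measurable (SampleTree.leaves : SampleTree C E L → _) :=
  measurable_pi_apply _

/-- The nodes of a tree at the positions `f l j`. -/
def SampleTree.pullback {L : ℕ} (f : ∀ l, NodeIndex C' l → NodeIndex C l) (T : SampleTree C E L) :
    SampleTree C' E L :=
  fun l j => T l (f l j)

theorem SampleTree.measurable_pullback {L : ℕ} (f : ∀ l, NodeIndex C' l → NodeIndex C l) :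
    Measurable (SampleTree.pullback f : SampleTree C E L → SampleTree C' E L) := by
  unfold SampleTree.pullback; fun_prop

/-- The nodes at the positions of an embedded tree form a hierarchical sample. -/
theorem treeLaw_map_pullback (f : ∀ l, NodeIndex C' l → NodeIndex C l)
    (hf : ∀ l, Function.Injective (f l))
    (hanc : ∀ l (p : NodeIndex C' (l + 1)),
      f l (p.ancestor l.le_succ) = (f (l + 1) p).ancestor l.le_succ) (L : ℕ) :
    (treeLaw C root K L).map (SampleTree.pullback f) = treeLaw C' root K L := by
  induction L with
  | zero =>
    unfold treeLaw
    rw [Measure.map_dirac' (SampleTree.measurable_pullback f)]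
    congr 1
    funext l j
    obtain rfl : l = 0 := Fin.eq_zero l
    rfl
  | succ L ih =>
    rw [treeLaw, treeLaw, ← ih, Measure.map_map (SampleTree.measurable_pullback f)
      SampleTree.measurable_extend,
      ← compProd_map_prodMap (treeLaw C root K L) (childrenKernel C K L)
        (SampleTree.measurable_pullback f)
        (s := fun x j => x (f (L + 1) j)) (by fun_prop) (childrenKernel C' K L),
      Measure.map_map SampleTree.measurable_extend
        ((SampleTree.measurable_pullback f).prodMap (by fun_prop))]
    · congr 1
      funext p l
      induction l using Fin.lastCases with
      | last =>
        funext j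
        simp only [Function.comp, SampleTree.extend_last, SampleTree.pullback]
        rfl
      | cast l =>
        funext j
        simp only [Function.comp, SampleTree.extend_castSucc, SampleTree.pullback, Prod.map]
        rfl
    · intro T
      simp only [childrenKernel_apply]
      rw [pi_map_comp_injective (hf (L + 1))]
      congr 1
      funext p
      simp only [SampleTree.leaves, SampleTree.pullback]
      exact congrArg (fun q => K L (T (Fin.last L) q)) (hanc L p).symm

theorem treeLaw_map_leaf (L : ℕ) (j : NodeIndex C L) :
    (treeLaw C root K L).map (fun T => T.leaves j) = chainLaw root K L := by
  induction L with
  | zero =>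
    have hm : Measurable fun T : SampleTree C E 0 => T.leaves j :=
      (measurable_pi_apply j).comp measurable_leaves
    unfold treeLaw chainLaw
    rw [Measure.map_dirac' hm]
    rfl
  | succ L ih =>
    rw [treeLaw, chainLaw, ← ih (j.ancestor L.le_succ)]
    have hm : Measurable fun T : SampleTree C E L => T.leaves (j.ancestor L.le_succ) :=
      (measurable_pi_apply _).comp measurable_leaves
    have hm' : Measurable fun T : SampleTree C E (L + 1) => T.leaves j :=
      (measurable_pi_apply _).comp measurable_leaves
    rw [Measure.map_map hm' SampleTree.measurable_extend]
    refine Measure.ext_of_lintegral _ fun g hg => ?_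
    have he : ∀ p : SampleTree C E L × (NodeIndex C (L + 1) → E (L + 1)),
        (SampleTree.extend p).leaves j = p.2 j := fun p =>
      congrFun (SampleTree.extend_last p) j
    rw [lintegral_map hg (hm'.comp SampleTree.measurable_extend), Measure.lintegral_bind
      (K L).measurable.aemeasurable hg.aemeasurable, lintegral_map (by fun_prop) hm]
    simp only [Function.comp, he]
    rw [Measure.lintegral_compProd (by fun_prop)]
    refine lintegral_congr fun T => ?_
    exact (measurePreserving_eval
      (fun p : NodeIndex C (L + 1) => K L (T.leaves (p.ancestor L.le_succ))) j).lintegral_comp hg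

open Classical in
/-- The tree whose nodes below the children in `S` of the root are those of the first tree, and
whose other nodes are those of the second tree. -/
noncomputable def SampleTree.merge {L : ℕ} (S : Set (C 0))
    (T : SampleTree C E L × SampleTree C E L) : SampleTree C E L :=
  fun l j => if ∃ h : 0 < (l : ℕ), j ⟨0, h⟩ ∈ S then T.1 l j else T.2 l j

theorem SampleTree.measurable_merge {L : ℕ} (S : Set (C 0)) :
    Measurable (SampleTree.merge S : SampleTree C E L × SampleTree C E L → _) := by
  refine measurable_pi_iff.2 fun l => measurable_pi_iff.2 fun j => ?_
  unfold SampleTree.merge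
  split_ifs <;> fun_prop

open Classical in
theorem SampleTree.merge_extend {L : ℕ} (S : Set (C 0))
    (p q : SampleTree C E L × (NodeIndex C (L + 1) → E (L + 1))) :
    SampleTree.merge S (SampleTree.extend p, SampleTree.extend q) =
      SampleTree.extend (SampleTree.merge S (p.1, q.1),
        fun j => if j ⟨0, L.succ_pos⟩ ∈ S then p.2 j else q.2 j) := by
  funext l j
  induction l using Fin.lastCases with
  | last =>
    simp only [SampleTree.merge, SampleTree.extend_last]
    simp
    rfl
  | cast l =>
    simp only [SampleTree.merge, SampleTree.extend_castSucc]
    rfl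

open Classical in
/-- Resampling the trees below some of the children of the root: two independent hierarchical
samples merge into a hierarchical sample. -/
theorem treeLaw_prod_map_merge (S : Set (C 0)) (L : ℕ) :
    ((treeLaw C root K L).prod (treeLaw C root K L)).map (SampleTree.merge S) =
      treeLaw C root K L := by
  induction L with
  | zero =>
    unfold treeLaw
    rw [Measure.dirac_prod_dirac, Measure.map_dirac' (SampleTree.measurable_merge S)]
    congr 1
    funext l j
    obtain rfl : l = 0 := Fin.eq_zero l
    simp [SampleTree.merge]
  | succ L ih =>
    have hmer := measurable_merge (β := E (L + 1))
      (fun j : NodeIndex C (L + 1) => j ⟨0, L.succ_pos⟩ ∈ S)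
    have hm0 := SampleTree.measurable_merge (L := L) (E := E) S
    have hm1 := SampleTree.measurable_merge (L := L + 1) (E := E) S
    have hex := SampleTree.measurable_extend (C := C) (E := E) (L := L)
    have hme : Measurable fun q : (SampleTree C E L × (NodeIndex C (L + 1) → E (L + 1))) ×
        (SampleTree C E L × (NodeIndex C (L + 1) → E (L + 1))) =>
        (SampleTree.merge S (q.1.1, q.2.1),
          fun j : NodeIndex C (L + 1) => if j ⟨0, L.succ_pos⟩ ∈ S then q.1.2 j else q.2.2 j) :=
      (hm0.comp (by fun_prop : Measurable fun q : (SampleTree C E L × _) × (_ × _) =>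
        (q.1.1, q.2.1))).prodMk
        (hmer.comp (by fun_prop : Measurable fun q : (_ × (NodeIndex C (L + 1) → _)) × (_ × _) =>
          (q.1.2, q.2.2)))
    have key : (((treeLaw C root K L ⊗ₘ childrenKernel C K L).prod
        (treeLaw C root K L ⊗ₘ childrenKernel C K L)).map fun q =>
          (SampleTree.merge S (q.1.1, q.2.1),
            fun j : NodeIndex C (L + 1) => if j ⟨0, L.succ_pos⟩ ∈ S then q.1.2 j else q.2.2 j)) =
        treeLaw C root K L ⊗ₘ childrenKernel C K L := by
      -- Depth one is special: the merged tree keeps the root of the second tree, while children in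
      -- `S` were drawn from the root of the first. The two roots agree only because their law is a
      -- Dirac mass. From depth two on, a node and its parent lie below the same child of the root,
      -- so both come from the same tree.
      rcases L with _ | L
      · unfold treeLaw at ih ⊢
        rw [dirac_compProd, Measure.map_prod_map _ _ (by fun_prop) (by fun_prop),
          Measure.map_map hme (by fun_prop)]
        set t : SampleTree C E 0 := Fin.cons (fun _ => root) fun i => i.elim0
        have h : ((childrenKernel C K 0 t).prod (childrenKernel C K 0 t)).map
            (fun x j => if j ⟨0, Nat.one_pos⟩ ∈ S then x.1 j else x.2 j) =
            childrenKernel C K 0 t := by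
          rw [childrenKernel_apply, pi_prod_map_merge]
          simp
        conv_rhs => rw [← h]
        rw [Measure.map_map (by fun_prop) hmer]
        congr 1
        funext q
        refine Prod.ext ?_ rfl
        funext l j
        obtain rfl : l = 0 := Fin.eq_zero l
        simp [SampleTree.merge]
      · rw [compProd_prod_compProd, Measure.map_map hme (by fun_prop)]
        conv_rhs => rw [← ih]
        rw [← compProd_map_prodMap _ (childrenKernel C K (L + 1) ∥ₖ childrenKernel C K (L + 1))
          hm0 hmer]
        · rfl
        · intro T
          rw [Kernel.parallelComp_apply]
          simp only [childrenKernel_apply]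
          rw [pi_prod_map_merge]
          congr 1
          funext j
          by_cases h : j ⟨0, (L + 1).succ_pos⟩ ∈ S
          · rw [if_pos h]
            exact congrArg (K (L + 1)) (if_pos ⟨(L.succ_pos : 0 < L + 1), h⟩).symm
          · rw [if_neg h]
            exact congrArg (K (L + 1)) (if_neg fun ⟨_, h'⟩ => h h').symm
    rw [treeLaw, Measure.map_prod_map _ _ hex hex, Measure.map_map hm1 (hex.prodMap hex)]
    conv_rhs => rw [← key]
    rw [Measure.map_map hex hme]
    congr 1
    funext q
    exact SampleTree.merge_extend S q.1 q.2

end TreeLaw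

/-! ### Information about a binary variable -/

section BinaryInformation

open Real InformationTheory

theorem integral_bool (ν : Measure Bool) [IsFiniteMeasure ν] (f : Bool → ℝ) :
    ∫ b, f b ∂ν = ν.real {true} * f true + ν.real {false} * f false := by
  rw [integral_fintype (.of_finite)]
  simp

theorem lintegral_bool (ν : Measure Bool) (f : Bool → ℝ≥0∞) :
    ∫⁻ b, f b ∂ν = f true * ν {true} + f false * ν {false} := by
  rw [lintegral_fintype]
  simp

theorem measureReal_false (ν : Measure Bool) [IsProbabilityMeasure ν] :
    ν.real {false} = 1 - ν.real {true} := by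
  have h : ({true} : Set Bool)ᶜ = {false} := by ext b; cases b <;> simp
  rw [← h, probReal_compl_eq_one_sub (measurableSet_singleton _)]

/-- The entropy of a distribution on two points. -/
noncomputable def boolEntropy (ν : Measure Bool) : ℝ := binEntropy (ν.real {true})

theorem boolEntropy_eq (ν : Measure Bool) [IsProbabilityMeasure ν] :
    boolEntropy ν =
      -(ν.real {true} * log (ν.real {true}) + ν.real {false} * log (ν.real {false})) := by
  rw [boolEntropy, binEntropy_eq_negMulLog_add_negMulLog_one_sub, measureReal_false]
  simp only [negMulLog]; ring

theorem boolEntropy_nonneg (ν : Measure Bool) [IsProbabilityMeasure ν] : 0 ≤ boolEntropy ν :=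
  binEntropy_nonneg measureReal_nonneg measureReal_le_one

theorem boolEntropy_le (ν : Measure Bool) : boolEntropy ν ≤ log 2 := binEntropy_le_log_two

variable {α β γ Ω : Type*} [MeasurableSpace α] [MeasurableSpace β] [MeasurableSpace γ]
  [MeasurableSpace Ω]

theorem Kernel.measurable_real (κ : Kernel α β) {s : Set β} (hs : MeasurableSet s) :
    Measurable fun a => (κ a).real s :=
  (κ.measurable_coe hs).ennreal_toReal

theorem measurable_boolEntropy (κ : Kernel α Bool) : Measurable fun a => boolEntropy (κ a) :=
  binEntropy_continuous.measurable.comp (Kernel.measurable_real κ (measurableSet_singleton _))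

theorem integrable_boolEntropy (κ : Kernel α Bool) [IsMarkovKernel κ] (μ : Measure α)
    [IsFiniteMeasure μ] : Integrable (fun a => boolEntropy (κ a)) μ :=
  Integrable.of_bound (measurable_boolEntropy κ).aestronglyMeasurable (log 2)
    (.of_forall fun a => by
      rw [Real.norm_of_nonneg (boolEntropy_nonneg _)]; exact boolEntropy_le _)

/-- Since one factor is finite, the density of a joint law with respect to the product of its
marginals is explicit, and absolute continuity needs no hypothesis. -/
theorem compProd_eq_withDensity_bool (μ : Measure β) [IsProbabilityMeasure μ]
    (κ : Kernel β Bool) [IsMarkovKernel κ] :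
    μ ⊗ₘ κ = (μ.prod (κ ∘ₘ μ)).withDensity fun p => κ p.1 {p.2} / (κ ∘ₘ μ) {p.2} := by
  set ν := κ ∘ₘ μ
  have hk : Measurable fun p : β × Bool => κ p.1 {p.2} :=
    measurable_from_prod_countable_left fun b => κ.measurable_coe (measurableSet_singleton b)
  have hh : Measurable fun p : β × Bool => κ p.1 {p.2} / ν {p.2} :=
    hk.div ((measurable_of_finite fun b : Bool => ν {b}).comp measurable_snd)
  refine Measure.ext_of_lintegral _ fun f hf => ?_
  rw [lintegral_withDensity_eq_lintegral_mul _ hh hf, Measure.lintegral_compProd hf,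
    lintegral_prod_symm _ (hh.mul hf).aemeasurable, lintegral_bool]
  simp_rw [lintegral_bool]
  rw [lintegral_add_left (by exact (hf.comp (by fun_prop)).mul (κ.measurable_coe (by simp)))]
  have key : ∀ b : Bool, ∫⁻ v, f (v, b) * κ v {b} ∂μ =
      (∫⁻ v, ((fun p : β × Bool => κ p.1 {p.2} / ν {p.2}) * f) (v, b) ∂μ) * ν {b} := by
    intro b
    rw [← lintegral_mul_const (ν {b}) (show Measurable fun v =>
      ((fun p : β × Bool => κ p.1 {p.2} / ν {p.2}) * f) (v, b) from
        (hh.mul hf).comp measurable_prodMk_right)]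
    have hν : ν {b} = ∫⁻ v, κ v {b} ∂μ := Measure.bind_apply (by simp) κ.aemeasurable
    -- If `b` has no mass under the marginal, then `κ v {b}` vanishes for almost every `v`, so the
    -- value of the quotient there does not matter.
    by_cases h0 : ν {b} = 0
    · rw [h0]
      rw [h0, eq_comm, lintegral_eq_zero_iff (κ.measurable_coe (by simp))] at hν
      refine lintegral_congr_ae ?_
      filter_upwards [hν] with v hv
      simp [show κ v {b} = 0 from hv]
    · refine lintegral_congr fun v => ?_
      simp only [Pi.mul_apply]
      rw [mul_right_comm, ENNReal.div_mul_cancel h0 (measure_ne_top _ _), mul_comm]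
  rw [key, key]

/-- The log-likelihood ratio is log κ_v(b) − log ν(b). Integrating each term turns the divergence
into a difference of entropies, finite because a binary entropy is at most log 2. -/
theorem klDiv_compProd_bool (μ : Measure β) [IsProbabilityMeasure μ]
    (κ : Kernel β Bool) [IsMarkovKernel κ] :
    klDiv (μ ⊗ₘ κ) (μ.prod (κ ∘ₘ μ)) ≠ ∞ ∧
      (klDiv (μ ⊗ₘ κ) (μ.prod (κ ∘ₘ μ))).toReal =
        boolEntropy (κ ∘ₘ μ) - ∫ v, boolEntropy (κ v) ∂μ := by
  have hd := compProd_eq_withDensity_bool μ κ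
  have hsnd : (μ ⊗ₘ κ).snd = κ ∘ₘ μ := Measure.snd_compProd μ κ
  set ν := κ ∘ₘ μ
  have hk : Measurable fun p : β × Bool => κ p.1 {p.2} :=
    measurable_from_prod_countable_left fun b => κ.measurable_coe (measurableSet_singleton b)
  have hh : Measurable fun p : β × Bool => κ p.1 {p.2} / ν {p.2} :=
    hk.div ((measurable_of_finite fun b : Bool => ν {b}).comp measurable_snd)
  have hac : μ ⊗ₘ κ ≪ μ.prod ν := by rw [hd]; exact withDensity_absolutelyContinuous _ _
  have hrn : (μ ⊗ₘ κ).rnDeriv (μ.prod ν) =ᵐ[μ ⊗ₘ κ] fun p => κ p.1 {p.2} / ν {p.2} := by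
    refine hac.ae_le ?_
    have h := Measure.rnDeriv_withDensity (μ.prod ν) hh
    rwa [← hd] at h
  have hk0 : ∀ᵐ p ∂(μ ⊗ₘ κ), κ p.1 {p.2} ≠ 0 := by
    refine (Measure.ae_compProd_iff (p := fun p => κ p.1 {p.2} ≠ 0)
      (hk (measurableSet_singleton 0)).compl).2 ?_
    refine .of_forall fun v => ?_
    rw [ae_iff_of_countable]
    exact fun b hb => hb
  have hν0 : ∀ᵐ p ∂(μ ⊗ₘ κ), ν {p.2} ≠ 0 := by
    have : ∀ᵐ b ∂ν, ν {b} ≠ 0 := by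
      rw [ae_iff_of_countable]; exact fun b hb => hb
    rw [show ae ν = ae ((μ ⊗ₘ κ).map Prod.snd) by rw [← hsnd]; rfl] at this
    exact ae_of_ae_map measurable_snd.aemeasurable this
  have hllr : llr (μ ⊗ₘ κ) (μ.prod ν) =ᵐ[μ ⊗ₘ κ]
      fun p => log ((κ p.1).real {p.2}) - log (ν.real {p.2}) := by
    filter_upwards [hrn, hk0, hν0] with p hp h1 h2
    rw [llr, hp, ENNReal.toReal_div]
    exact log_div (ENNReal.toReal_ne_zero.2 ⟨h1, measure_ne_top _ _⟩)
      (ENNReal.toReal_ne_zero.2 ⟨h2, measure_ne_top _ _⟩)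
  have hm1 : Measurable fun p : β × Bool => log ((κ p.1).real {p.2}) :=
    hk.ennreal_toReal.log
  -- Logarithms of probabilities are nonpositive, so the inner integral of the norm is exactly the
  -- entropy of `κ v`, which is bounded.
  have hi1 : Integrable (fun p : β × Bool => log ((κ p.1).real {p.2})) (μ ⊗ₘ κ) := by
    rw [Measure.integrable_compProd_iff hm1.aestronglyMeasurable]
    refine ⟨.of_forall fun v => .of_finite, ?_⟩
    refine (integrable_boolEntropy κ μ).congr (.of_forall fun v => ?_)
    simp only
    rw [integral_bool, boolEntropy_eq]
    have : ∀ b, ‖log ((κ v).real {b})‖ = - log ((κ v).real {b}) := fun b => by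
      rw [Real.norm_of_nonpos]
      exact log_nonpos measureReal_nonneg measureReal_le_one
    rw [this, this]; ring
  have hi2 : Integrable (fun p : β × Bool => log (ν.real {p.2})) (μ ⊗ₘ κ) := by
    have : Integrable (fun b : Bool => log (ν.real {b})) (μ ⊗ₘ κ).snd := by
      exact .of_finite
    exact this.comp_measurable measurable_snd
  refine ⟨klDiv_ne_top hac ((hi1.sub hi2).congr hllr.symm), ?_⟩
  rw [toReal_klDiv_of_measure_eq hac (by simp), integral_congr_ae hllr, integral_sub hi1 hi2,
    Measure.integral_compProd hi1]
  have h2 : ∫ p, log (ν.real {p.2}) ∂(μ ⊗ₘ κ) = - boolEntropy ν := by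
    have : ∫ b, log (ν.real {b}) ∂(μ ⊗ₘ κ).snd = ∫ p, log (ν.real {p.2}) ∂(μ ⊗ₘ κ) :=
      integral_map measurable_snd.aemeasurable
        (measurable_of_finite _).aestronglyMeasurable
    rw [← this, hsnd, integral_bool, boolEntropy_eq, neg_neg]
  have h1 : ∫ v, ∫ b, log ((κ v).real {b}) ∂κ v ∂μ = - ∫ v, boolEntropy (κ v) ∂μ := by
    rw [← integral_neg]
    refine integral_congr_ae (.of_forall fun v => ?_)
    simp only
    rw [integral_bool, boolEntropy_eq, neg_neg]
  rw [h1, h2]; ring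

/-! ### Conditional mutual information as a difference of conditional entropies -/

variable [StandardBorelSpace β] [Nonempty β] {V : Ω → β} {U : Ω → Bool} {Z : Ω → γ}
  {P : Measure Ω} [IsProbabilityMeasure P]

theorem condDistrib_prodMk_ae_eq {δ : Type*} [MeasurableSpace δ] [StandardBorelSpace δ]
    [Nonempty δ] {U : Ω → δ} (hV : Measurable V) (hU : Measurable U) (hZ : Measurable Z) :
    condDistrib (fun ω => (V ω, U ω)) Z P =ᵐ[P.map Z]
      condDistrib V Z P ⊗ₖ condDistrib U (fun ω => (Z ω, V ω)) P := by
  refine condDistrib_ae_eq_of_measure_eq_compProd Z (by fun_prop) ?_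
  rw [← Measure.compProd_assoc', compProd_map_condDistrib hV.aemeasurable,
    compProd_map_condDistrib hU.aemeasurable, Measure.map_map (by fun_prop) (by fun_prop)]
  rfl

theorem condDistrib_prodMk_ae (hV : Measurable V) (hU : Measurable U) (hZ : Measurable Z) :
    ∀ᵐ z ∂P.map Z,
      condDistrib (fun ω => (V ω, U ω)) Z P z = condDistrib V Z P z ⊗ₘ
        (condDistrib U (fun ω => (Z ω, V ω)) P).sectR z ∧
      condDistrib U Z P z =
        (condDistrib U (fun ω => (Z ω, V ω)) P).sectR z ∘ₘ condDistrib V Z P z := by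
  filter_upwards [condDistrib_prodMk_ae_eq (P := P) hV hU hZ,
    condDistrib_comp (μ := P) Z (hV.prodMk hU).aemeasurable (f := Prod.snd) measurable_snd]
    with z h1 h2
  have h3 : condDistrib (fun ω => (V ω, U ω)) Z P z = condDistrib V Z P z ⊗ₘ
        (condDistrib U (fun ω => (Z ω, V ω)) P).sectR z := by
    rw [h1, Kernel.compProd_apply_eq_compProd_sectR]
  refine ⟨h3, ?_⟩
  rw [Kernel.map_apply _ measurable_snd, h3] at h2
  rw [← Measure.snd_compProd]
  exact h2

theorem condMutualInfoAt_ae (hV : Measurable V) (hU : Measurable U) (hZ : Measurable Z) :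
    ∀ᵐ z ∂P.map Z, condMutualInfoAt V U Z P z ≠ ∞ ∧
      (condMutualInfoAt V U Z P z).toReal = boolEntropy (condDistrib U Z P z) -
        ∫ v, boolEntropy (condDistrib U (fun ω => (Z ω, V ω)) P (z, v)) ∂condDistrib V Z P z := by
  filter_upwards [condDistrib_prodMk_ae (P := P) hV hU hZ] with z hz
  rw [condMutualInfoAt, hz.1, hz.2]
  exact klDiv_compProd_bool _ _

/-- The conditional entropy of `U` given `Z`. -/
noncomputable def condEntropy (U : Ω → Bool) (Z : Ω → γ) (P : Measure Ω) [IsFiniteMeasure P] : ℝ :=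
  ∫ z, boolEntropy (condDistrib U Z P z) ∂P.map Z

theorem condMutualInfoAt_ae_eq (hV : Measurable V) (hU : Measurable U) (hZ : Measurable Z) :
    condMutualInfoAt V U Z P =ᵐ[P.map Z] fun z =>
      ENNReal.ofReal (boolEntropy (condDistrib U Z P z) -
        ∫ v, boolEntropy (condDistrib U (fun ω => (Z ω, V ω)) P (z, v)) ∂condDistrib V Z P z) := by
  filter_upwards [condMutualInfoAt_ae (P := P) hV hU hZ] with z hz
  rw [← hz.2, ENNReal.ofReal_toReal hz.1]

theorem measurable_integral_boolEntropy : Measurable fun z =>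
      ∫ v, boolEntropy (condDistrib U (fun ω => (Z ω, V ω)) P (z, v)) ∂condDistrib V Z P z :=
  (StronglyMeasurable.integral_kernel_prod_right'
    (measurable_boolEntropy (condDistrib U (fun ω => (Z ω, V ω)) P)).stronglyMeasurable).measurable

/-- Measurability in z is read off the entropy formula, in which only kernels and integrals appear.
-/
theorem aemeasurable_condMutualInfoAt (hV : Measurable V) (hU : Measurable U)
    (hZ : Measurable Z) : AEMeasurable (condMutualInfoAt V U Z P) (P.map Z) :=
  ⟨_, ((measurable_boolEntropy _).sub
    (measurable_integral_boolEntropy)).ennreal_ofReal, condMutualInfoAt_ae_eq hV hU hZ⟩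

theorem condMutualInfo_eq (hV : Measurable V) (hU : Measurable U) (hZ : Measurable Z) :
    condMutualInfo V U Z P =
      ENNReal.ofReal (condEntropy U Z P - condEntropy U (fun ω => (Z ω, V ω)) P) ∧
    condEntropy U (fun ω => (Z ω, V ω)) P ≤ condEntropy U Z P := by
  have hi1 := integrable_boolEntropy (condDistrib U Z P) (P.map Z)
  have hi : Integrable (fun p => boolEntropy (condDistrib U (fun ω => (Z ω, V ω)) P p))
    (P.map Z ⊗ₘ condDistrib V Z P) := integrable_boolEntropy _ _
  have hi2 : Integrable (fun z => ∫ v,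
      boolEntropy (condDistrib U (fun ω => (Z ω, V ω)) P (z, v)) ∂condDistrib V Z P z)
      (P.map Z) := by
    simpa using hi.integral_compProd
  have h2 : condEntropy U (fun ω => (Z ω, V ω)) P = ∫ z, ∫ v,
      boolEntropy (condDistrib U (fun ω => (Z ω, V ω)) P (z, v)) ∂condDistrib V Z P z ∂P.map Z := by
    rw [condEntropy, ← compProd_map_condDistrib hV.aemeasurable, Measure.integral_compProd hi]
  have h0 : ∀ᵐ z ∂P.map Z, 0 ≤ boolEntropy (condDistrib U Z P z) -
      ∫ v, boolEntropy (condDistrib U (fun ω => (Z ω, V ω)) P (z, v)) ∂condDistrib V Z P z := by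
    filter_upwards [condMutualInfoAt_ae (P := P) hV hU hZ] with z hz
    rw [← hz.2]; exact ENNReal.toReal_nonneg
  have h3 : condEntropy U Z P - condEntropy U (fun ω => (Z ω, V ω)) P =
      ∫ z, (boolEntropy (condDistrib U Z P z) - ∫ v,
        boolEntropy (condDistrib U (fun ω => (Z ω, V ω)) P (z, v)) ∂condDistrib V Z P z)
        ∂P.map Z := by
    rw [h2, condEntropy, integral_sub hi1 hi2]
  refine ⟨?_, ?_⟩
  · rw [condMutualInfo, lintegral_congr_ae (condMutualInfoAt_ae_eq hV hU hZ), h3]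
    exact (ofReal_integral_eq_lintegral_ofReal (hi1.sub hi2) h0).symm
  · rw [← sub_nonneg, h3]
    exact integral_nonneg_of_ae h0

/-- Data processing for the swap and for its inverse. -/
theorem klDiv_map_swap (μ ν : Measure (α × β)) [IsFiniteMeasure μ] [IsFiniteMeasure ν] :
    klDiv (μ.map Prod.swap) (ν.map Prod.swap) = klDiv μ ν := by
  refine le_antisymm (klDiv_map_le _ _ measurable_swap) ?_
  have h := klDiv_map_le (μ.map Prod.swap) (ν.map Prod.swap) measurable_swap
  simpa [Measure.map_map measurable_swap measurable_swap] using h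

theorem condMutualInfo_comm (hV : Measurable V) (hU : Measurable U) :
    condMutualInfo U V Z P = condMutualInfo V U Z P := by
  refine lintegral_congr_ae ?_
  filter_upwards [condDistrib_comp (μ := P) Z (hV.prodMk hU).aemeasurable (f := Prod.swap)
    measurable_swap] with z hz
  rw [Kernel.map_apply _ measurable_swap] at hz
  rw [condMutualInfoAt, condMutualInfoAt, ← Measure.prod_swap,
    ← klDiv_map_swap (condDistrib (fun ω => (V ω, U ω)) Z P z), ← hz]
  rfl

/-- Jensen's inequality for the square root of the information. -/
theorem lintegral_sqrt_condMutualInfoAt_le (hV : Measurable V) (hU : Measurable U)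
    (hZ : Measurable Z) :
    ∫⁻ ω, (2 * condMutualInfoAt V U Z P (Z ω)) ^ (1 / 2 : ℝ) ∂P ≤
      (2 * condMutualInfo V U Z P) ^ (1 / 2 : ℝ) := by
  have hm : AEMeasurable (fun z => 2 * condMutualInfoAt V U Z P z) (P.map Z) :=
    (aemeasurable_condMutualInfoAt hV hU hZ).const_mul 2
  have hP := Measure.isProbabilityMeasure_map (μ := P) hZ.aemeasurable
  rw [← lintegral_map' (f := fun z => (2 * condMutualInfoAt V U Z P z) ^ (1 / 2 : ℝ))
    (hm.pow_const _) hZ.aemeasurable, condMutualInfo, ← lintegral_const_mul'' _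
    (aemeasurable_condMutualInfoAt hV hU hZ)]
  -- Cauchy–Schwarz against the constant 1, whose norm is 1 because the law of `Z` is a probability
  -- measure.
  have h := ENNReal.lintegral_mul_le_Lp_mul_Lq (P.map Z) Real.HolderConjugate.two_two
    (hm.pow_const (1 / 2 : ℝ)) (aemeasurable_const (b := (1 : ℝ≥0∞)))
  have hs : ∀ x : ℝ≥0∞, (x ^ (1 / 2 : ℝ)) ^ (2 : ℝ) = x := fun x => by
    rw [← ENNReal.rpow_mul]; norm_num
  simpa only [hs, Pi.mul_apply, mul_one, ENNReal.one_rpow, lintegral_one, measure_univ] using h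

end BinaryInformation

/-! ### Fair decisions -/

section Fair

open Real

/-- The law of a fair decision. -/
noncomputable abbrev fairCoin : Measure Bool := (PMF.uniformOfFintype Bool).toMeasure

theorem fairCoin_singleton (b : Bool) : fairCoin {b} = 2⁻¹ := by
  rw [PMF.toMeasure_apply_singleton _ _ (measurableSet_singleton b)]
  simp

theorem boolEntropy_fairCoin : boolEntropy fairCoin = log 2 := by
  rw [boolEntropy, measureReal_def, fairCoin_singleton]
  simp

variable {α β γ Ω : Type*} [MeasurableSpace α] [MeasurableSpace β] [MeasurableSpace γ]
  [MeasurableSpace Ω]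

/-- Given `Z`, the decision `U` is fair. -/
def IsFairGiven (U : Ω → Bool) (Z : Ω → γ) (P : Measure Ω) : Prop :=
  P.map (fun ω => (Z ω, U ω)) = (P.map Z).prod fairCoin

variable {U : Ω → Bool} {Z : Ω → γ} {P : Measure Ω} [IsProbabilityMeasure P]

theorem IsFairGiven.comp (h : IsFairGiven U Z P) (hU : Measurable U) (hZ : Measurable Z)
    {f : γ → α} (hf : Measurable f) : IsFairGiven U (fun ω => f (Z ω)) P := by
  have h1 : P.map (fun ω => (f (Z ω), U ω)) = (P.map fun ω => (Z ω, U ω)).map (Prod.map f id) := by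
    rw [Measure.map_map (hf.prodMap measurable_id) (by fun_prop)]; rfl
  have h2 : P.map (fun ω => f (Z ω)) = (P.map Z).map f := by
    rw [Measure.map_map hf hZ]; rfl
  rw [IsFairGiven, h1, h, h2, ← Measure.map_prod_map _ _ hf measurable_id, Measure.map_id]

theorem IsFairGiven.condDistrib_ae_eq (h : IsFairGiven U Z P) (hU : Measurable U) :
    condDistrib U Z P =ᵐ[P.map Z] Kernel.const _ fairCoin :=
  condDistrib_ae_eq_of_measure_eq_compProd Z hU.aemeasurable (by
    rw [Measure.compProd_const]; exact h)

theorem IsFairGiven.condEntropy_eq (h : IsFairGiven U Z P) (hU : Measurable U)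
    (hZ : Measurable Z) : condEntropy U Z P = log 2 := by
  have hP := Measure.isProbabilityMeasure_map (μ := P) hZ.aemeasurable
  rw [condEntropy, integral_congr_ae (g := fun _ => log 2)]
  · simp
  · filter_upwards [h.condDistrib_ae_eq hU] with z hz
    rw [hz, Kernel.const_apply, boolEntropy_fairCoin]

theorem IsFairGiven.lintegral_eq (h : IsFairGiven U Z P) (hU : Measurable U) (hZ : Measurable Z)
    {f : γ × Bool → ℝ≥0∞} (hf : Measurable f) :
    ∫⁻ ω, f (Z ω, U ω) ∂P = ∫⁻ ω, ∫⁻ b, f (Z ω, b) ∂fairCoin ∂P := by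
  rw [← lintegral_map hf (hZ.prodMk hU), h, lintegral_prod _ hf.aemeasurable,
    lintegral_map hf.lintegral_prod_right' hZ]

variable [StandardBorelSpace α] [Nonempty α] {W : Ω → α}

/-- Bayes' rule for a fair decision. -/
theorem IsFairGiven.bayes (h : IsFairGiven U Z P) (hU : Measurable U) (hZ : Measurable Z)
    (hW : Measurable W) :
    ∀ᵐ z ∂P.map Z,
      (fairCoin ⊗ₘ (condDistrib W (fun ω => (Z ω, U ω)) P).sectR z).map Prod.swap =
        condDistrib W Z P z ⊗ₘ (condDistrib U (fun ω => (Z ω, W ω)) P).sectR z := by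
  -- Both sides are the conditional law of (W, U) given Z, disintegrated in the two possible orders.
  filter_upwards [condDistrib_prodMk_ae_eq (P := P) hU hW hZ, h.condDistrib_ae_eq hU,
    condDistrib_prodMk_ae_eq (P := P) hW hU hZ,
    condDistrib_comp (μ := P) Z (hU.prodMk hW).aemeasurable (f := Prod.swap) measurable_swap]
    with z h1 h2 h3 h4
  rw [Kernel.map_apply _ measurable_swap, h1, Kernel.compProd_apply_eq_compProd_sectR, h2,
    Kernel.const_apply] at h4
  rw [← h4, ← Kernel.compProd_apply_eq_compProd_sectR, ← h3]
  rfl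

/-- Bayes' rule tested on the sets `s ×ˢ {b}`; the factor 2 is the inverse of the prior mass of `b`.
-/
theorem IsFairGiven.condDistrib_eq_withDensity (h : IsFairGiven U Z P) (hU : Measurable U)
    (hZ : Measurable Z) (hW : Measurable W) :
    ∀ᵐ z ∂P.map Z, ∀ b, condDistrib W (fun ω => (Z ω, U ω)) P (z, b) =
      (condDistrib W Z P z).withDensity
        fun w => 2 * condDistrib U (fun ω => (Z ω, W ω)) P (z, w) {b} := by
  filter_upwards [h.bayes hU hZ hW] with z hz b
  ext s hs
  have h1 := DFunLike.congr_fun hz (s ×ˢ {b})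
  rw [Measure.map_apply measurable_swap (hs.prod (measurableSet_singleton b)),
    Set.preimage_swap_prod, Measure.compProd_apply_prod (measurableSet_singleton b) hs,
    Measure.compProd_apply_prod hs (measurableSet_singleton b), lintegral_singleton,
    fairCoin_singleton] at h1
  simp only [Kernel.sectR_apply] at h1
  rw [withDensity_apply _ hs, lintegral_const_mul' _ _ (by simp), ← h1, mul_left_comm,
    ENNReal.mul_inv_cancel (by simp) (by simp), mul_one]

theorem IsMarkovChain.lintegral_eq {X : Ω → β} {V : Ω → γ}
    (h : IsMarkovChain X V W P) (hX : Measurable X) (hV : Measurable V) (hW : Measurable W)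
    {f : (β × γ) × α → ℝ≥0∞} (hf : Measurable f) :
    ∫⁻ ω, f ((X ω, V ω), W ω) ∂P =
      ∫⁻ ω, ∫⁻ w, f ((X ω, V ω), w) ∂condDistrib W V P (V ω) ∂P := by
  rw [← lintegral_map (f := f) (g := fun ω => ((X ω, V ω), W ω)) hf (by fun_prop),
    ← compProd_map_condDistrib hW.aemeasurable, Measure.lintegral_compProd hf,
    lintegral_map hf.lintegral_kernel_prod_right' (hX.prodMk hV)]
  refine lintegral_congr_ae ?_
  filter_upwards [h] with ω hω
  rw [hω]

/-- If `X - (Z, U) - W` is a Markov chain and `U` is fair given `(X, Z)`, then `X` carries no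
information about `U` beyond that in `(Z, W)`. -/
theorem IsMarkovChain.condEntropy_eq {X : Ω → β}
    (hM : IsMarkovChain X (fun ω => (Z ω, U ω)) W P)
    (hF : IsFairGiven U (fun ω => (X ω, Z ω)) P) (hX : Measurable X) (hU : Measurable U)
    (hZ : Measurable Z) (hW : Measurable W) :
    condEntropy U (fun ω => ((X ω, W ω), Z ω)) P = condEntropy U (fun ω => (Z ω, W ω)) P := by
  have hFZ : IsFairGiven U Z P := hF.comp hU (hX.prodMk hZ) measurable_snd
  have hp : Measurable fun p : (β × α) × γ => (p.2, p.1.2) := by fun_prop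
  -- By fairness and the Markov property, the joint law arises from (X, Z) by drawing a fair U and
  -- then W from P_{W|Z,U}. So X does not affect the law of (U, W) once Z is known.
  have hexp : ∀ f : ((β × α) × γ) × Bool → ℝ≥0∞, Measurable f →
      ∫⁻ ω, f (((X ω, W ω), Z ω), U ω) ∂P =
        ∫⁻ ω, ∫⁻ q, f (((X ω, q.2), Z ω), q.1) ∂(fairCoin ⊗ₘ
          (condDistrib W (fun ω => (Z ω, U ω)) P).sectR (Z ω)) ∂P := by
    intro f hf
    have h1 := hM.lintegral_eq hX (hZ.prodMk hU) hW
      (f := fun q => f (((q.1.1, q.2), q.1.2.1), q.1.2.2)) (by fun_prop)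
    have h2 := hF.lintegral_eq hU (hX.prodMk hZ)
      (f := fun q => ∫⁻ w, f (((q.1.1, w), q.1.2), q.2)
        ∂condDistrib W (fun ω => (Z ω, U ω)) P (q.1.2, q.2))
      (Measurable.lintegral_kernel_prod_right'
        (κ := (condDistrib W (fun ω => (Z ω, U ω)) P).comap
          (fun q : (β × γ) × Bool => (q.1.2, q.2)) (by fun_prop))
        (f := fun q => f (((q.1.1.1, q.2), q.1.1.2), q.1.2)) (by fun_prop))
    simp only at h1 h2
    rw [h1, h2]
    refine lintegral_congr fun ω => ?_
    rw [Measure.lintegral_compProd (by fun_prop)]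
    rfl
  have hae : condDistrib U (fun ω => ((X ω, W ω), Z ω)) P =ᵐ[P.map fun ω => ((X ω, W ω), Z ω)]
      (condDistrib U (fun ω => (Z ω, W ω)) P).comap _ hp := by
    refine condDistrib_ae_eq_of_measure_eq_compProd _ hU.aemeasurable ?_
    refine Measure.ext_of_lintegral _ fun f hf => ?_
    rw [Measure.lintegral_compProd hf, lintegral_map hf (by fun_prop),
      lintegral_map hf.lintegral_kernel_prod_right' (by fun_prop), hexp f hf,
      hexp (fun q => ∫⁻ u, f (q.1, u) ∂((condDistrib U (fun ω => (Z ω, W ω)) P).comap _ hp) q.1)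
        (hf.lintegral_kernel_prod_right'.comp measurable_fst)]
    refine lintegral_congr_ae ?_
    -- Reversing the order inside the integral draws W from P_{W|Z} and then U from P_{U|Z,W}. The
    -- proposed kernel therefore reproduces the joint law.
    filter_upwards [ae_of_ae_map hZ.aemeasurable (hFZ.bayes hU hZ hW)] with ω hω
    have hsw : ∀ g : α × Bool → ℝ≥0∞, Measurable g →
        ∫⁻ q, g (q.2, q.1) ∂(fairCoin ⊗ₘ
          (condDistrib W (fun ω => (Z ω, U ω)) P).sectR (Z ω)) =
        ∫⁻ w, ∫⁻ b, g (w, b) ∂condDistrib U (fun ω => (Z ω, W ω)) P (Z ω, w)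
          ∂condDistrib W Z P (Z ω) := by
      intro g hg
      have := Measure.lintegral_compProd (μ := condDistrib W Z P (Z ω))
        (κ := (condDistrib U (fun ω => (Z ω, W ω)) P).sectR (Z ω)) hg
      rw [← hω, lintegral_map hg measurable_swap] at this
      exact this
    rw [hsw (fun q => f (((X ω, q.1), Z ω), q.2)) (by fun_prop),
      hsw (fun q => ∫⁻ u, f (((X ω, q.1), Z ω), u)
        ∂((condDistrib U (fun ω => (Z ω, W ω)) P).comap _ hp) ((X ω, q.1), Z ω))
        (hf.lintegral_kernel_prod_right'.comp (by fun_prop))]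
    refine lintegral_congr fun w => ?_
    simp only [Kernel.comap_apply]
    rw [lintegral_const, measure_univ, mul_one]
  have hpp : P.map (fun ω => (Z ω, W ω)) =
      (P.map fun ω => ((X ω, W ω), Z ω)).map fun p => (p.2, p.1.2) := by
    rw [Measure.map_map hp (by fun_prop)]; rfl
  rw [condEntropy, condEntropy, hpp,
    integral_map hp.aemeasurable (measurable_boolEntropy _).aestronglyMeasurable]
  refine integral_congr_ae ?_
  filter_upwards [hae] with p hp'
  rw [hp', Kernel.comap_apply]

/-- The gap between the information in `W` about `U` given `Z` and that given `X`. -/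
theorem IsMarkovChain.condMutualInfo_sub {X : Ω → β} [StandardBorelSpace γ] [Nonempty γ]
    (hM : IsMarkovChain X (fun ω => (Z ω, U ω)) W P)
    (hF : IsFairGiven U (fun ω => (X ω, Z ω)) P) (hX : Measurable X) (hU : Measurable U)
    (hZ : Measurable Z) (hW : Measurable W) :
    condMutualInfo W U X P ≤ condMutualInfo W U Z P ∧ condMutualInfo W U Z P ≠ ∞ ∧
      condMutualInfo W U Z P - condMutualInfo W U X P =
        condMutualInfo U Z (fun ω => (X ω, W ω)) P := by
  have hFZ : IsFairGiven U Z P := hF.comp hU (hX.prodMk hZ) measurable_snd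
  have hFX : IsFairGiven U X P := hF.comp hU (hX.prodMk hZ) measurable_fst
  have e := hM.condEntropy_eq hF hX hU hZ hW
  obtain ⟨h1, h1'⟩ := condMutualInfo_eq (P := P) hW hU hZ
  obtain ⟨h2, h2'⟩ := condMutualInfo_eq (P := P) hW hU hX
  obtain ⟨h3, h3'⟩ := condMutualInfo_eq (P := P) hZ hU (hX.prodMk hW)
  -- The entropy formula needs the binary variable in second place, hence the exchange of U and Z in
  -- the gap.
  rw [condMutualInfo_comm (P := P) hZ hU, h1, h2, h3, e]
  rw [e] at h3'
  rw [hFZ.condEntropy_eq hU hZ] at *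
  rw [hFX.condEntropy_eq hU hX] at *
  refine ⟨ENNReal.ofReal_le_ofReal (by linarith), ENNReal.ofReal_ne_top, ?_⟩
  rw [← ENNReal.ofReal_sub _ (by linarith)]
  congr 1
  ring

end Fair

/-! ### Transport cost for the discrete metric -/

section Transport

open Real

variable {𝒲 : Type*} [MeasurableSpace 𝒲]

theorem transportCost_le {c : 𝒲 → 𝒲 → ℝ≥0∞} (ρ : Measure (𝒲 × 𝒲)) :
    transportCost c ρ.fst ρ.snd ≤ ∫⁻ p, c p.1 p.2 ∂ρ :=
  iInf₂_le ρ ⟨rfl, rfl⟩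

theorem ofReal_integral_le_lintegral {α : Type*} [MeasurableSpace α] {μ : Measure α} {f : α → ℝ}
    (hf : Integrable f μ) : ENNReal.ofReal (∫ x, f x ∂μ) ≤ ∫⁻ x, ENNReal.ofReal (f x) ∂μ := by
  calc ENNReal.ofReal (∫ x, f x ∂μ)
      ≤ ENNReal.ofReal (∫ x, max (f x) 0 ∂μ) :=
        ENNReal.ofReal_le_ofReal (integral_mono hf hf.pos_part fun x => le_max_left _ _)
    _ = ∫⁻ x, ENNReal.ofReal (f x) ∂μ := by
        rw [ofReal_integral_eq_lintegral_ofReal hf.pos_part (.of_forall fun x => le_max_right _ _)]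
        simp [ENNReal.ofReal_max]

/-- A difference of means is at most the transport cost, if the cost dominates the differences of
the integrand. -/
theorem ofReal_integral_sub_le_transportCost {c : 𝒲 → 𝒲 → ℝ≥0∞} {P Q : Measure 𝒲}
    [IsProbabilityMeasure P] [IsProbabilityMeasure Q] {g : 𝒲 → ℝ}
    {a : ℝ≥0∞} (ha : a ≠ ∞) (hP : Integrable g P) (hQ : Integrable g Q)
    (hg : ∀ w w', ENNReal.ofReal (g w - g w') ≤ a * c w w') :
    ENNReal.ofReal (∫ w, g w ∂P - ∫ w, g w ∂Q) ≤ a * transportCost c P Q := by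
  -- A factor can be moved into an infimum only if it is nonzero. For `a = 0` the hypothesis forces
  -- `g` to be constant.
  by_cases ha0 : a = 0
  · subst ha0
    have hle : ∀ w w', g w ≤ g w' := fun w w' => by
      simpa [ENNReal.ofReal_eq_zero, sub_nonpos] using hg w w'
    obtain ⟨w₀⟩ := nonempty_of_isProbabilityMeasure P
    have hc : g = fun _ => g w₀ := funext fun w => le_antisymm (hle _ _) (hle _ _)
    rw [hc]
    simp
  rw [transportCost, ENNReal.mul_iInf_of_ne ha0 ha]
  refine le_iInf fun ρ => ?_
  rw [ENNReal.mul_iInf_of_ne ha0 ha]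
  refine le_iInf fun h => ?_
  obtain ⟨rfl, rfl⟩ := h
  have e1 : ∫ w, g w ∂ρ.fst = ∫ p, g p.1 ∂ρ :=
    integral_map measurable_fst.aemeasurable hP.aestronglyMeasurable
  have e2 : ∫ w, g w ∂ρ.snd = ∫ p, g p.2 ∂ρ :=
    integral_map measurable_snd.aemeasurable hQ.aestronglyMeasurable
  have i1 : Integrable (fun p => g p.1) ρ := hP.comp_measurable measurable_fst
  have i2 : Integrable (fun p => g p.2) ρ := hQ.comp_measurable measurable_snd
  rw [e1, e2, ← integral_sub i1 i2]
  calc ENNReal.ofReal (∫ p, (g p.1 - g p.2) ∂ρ)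
      ≤ ∫⁻ p, ENNReal.ofReal (g p.1 - g p.2) ∂ρ :=
        ofReal_integral_le_lintegral (i1.sub i2)
    _ ≤ ∫⁻ p, a * c p.1 p.2 ∂ρ := lintegral_mono fun p => hg _ _
    _ = a * ∫⁻ p, c p.1 p.2 ∂ρ := lintegral_const_mul' _ _ ha

theorem discreteDist_self (w : 𝒲) : discreteDist w w = 0 := by simp [discreteDist]

theorem discreteDist_le_one (w w' : 𝒲) : discreteDist w w' ≤ 1 := by
  unfold discreteDist; split_ifs <;> simp

theorem measurable_discreteDist [StandardBorelSpace 𝒲] :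
    Measurable fun p : 𝒲 × 𝒲 => discreteDist p.1 p.2 := by
  have hd : MeasurableSet {p : 𝒲 × 𝒲 | p.1 = p.2} :=
    measurableSet_eq_fun measurable_fst measurable_snd
  exact Measurable.ite hd measurable_const measurable_const

/-- The transport cost for the discrete metric is at most the total variation distance. -/
theorem transportCost_discreteDist_le [StandardBorelSpace 𝒲] (μ : Measure 𝒲)
    [IsProbabilityMeasure μ] {f : 𝒲 → ℝ≥0∞} (hf : Measurable f)
    [IsProbabilityMeasure (μ.withDensity f)] :
    transportCost discreteDist (μ.withDensity f) μ ≤ ∫⁻ w, (1 - f w) ∂μ := by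
  -- Here `m` is the common part of the two laws, `a` the excess of the first and `b` the excess of
  -- the second; the two excesses have equal mass.
  set m := μ.withDensity fun w => min (f w) 1
  set a := μ.withDensity fun w => f w - min (f w) 1
  set b := μ.withDensity fun w => 1 - f w
  have hmin : Measurable fun w => min (f w) 1 := hf.min measurable_const
  have hP : m + a = μ.withDensity f := by
    rw [← withDensity_add_left hmin]
    congr 1
    funext w
    exact add_tsub_cancel_of_le (min_le_left _ _)
  have hQ : m + b = μ := by
    rw [← withDensity_add_left hmin]
    conv_rhs => rw [← withDensity_one (μ := μ)]
    congr 1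
    funext w
    simp only [Pi.add_apply, Pi.one_apply]
    rcases le_total (f w) 1 with h | h
    · rw [min_eq_left h, add_tsub_cancel_of_le h]
    · rw [min_eq_right h, tsub_eq_zero_of_le h, add_zero]
  have hP1 : m Set.univ + a Set.univ = 1 := by
    rw [← Measure.add_apply, hP, measure_univ]
  have hQ1 : m Set.univ + b Set.univ = 1 := by
    rw [← Measure.add_apply, hQ, measure_univ]
  have hmfin : m Set.univ ≠ ∞ := ne_top_of_le_ne_top ENNReal.one_ne_top (hP1 ▸ le_self_add)
  have hafin : a Set.univ ≠ ∞ := ne_top_of_le_ne_top ENNReal.one_ne_top (hP1 ▸ le_add_self)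
  have hab : a Set.univ = b Set.univ := (ENNReal.add_right_inj hmfin).1 (hP1.trans hQ1.symm)
  have : IsFiniteMeasure a := ⟨hafin.lt_top⟩
  have : IsFiniteMeasure b := ⟨(hab ▸ hafin).lt_top⟩
  have hb : b Set.univ = ∫⁻ w, (1 - f w) ∂μ := by
    rw [withDensity_apply _ MeasurableSet.univ, Measure.restrict_univ]
  set t := b Set.univ
  -- The maximal coupling: the common part stays on the diagonal at no cost, and the excesses are
  -- coupled independently, normalized by their mass `t`. For `t = 0` both excesses vanish, so the
  -- infinite inverse is harmless.
  set ρ : Measure (𝒲 × 𝒲) := m.map (fun w => (w, w)) + t⁻¹ • a.prod b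
  have hdiag : Measurable fun w : 𝒲 => (w, w) := by fun_prop
  have htt : ∀ ξ : Measure 𝒲, ξ Set.univ = t → (t⁻¹ * t) • ξ = ξ := by
    intro ξ hξ
    by_cases h0 : t = 0
    · rw [Measure.measure_univ_eq_zero.1 (hξ.trans h0), smul_zero]
    · rw [ENNReal.inv_mul_cancel h0 (hab ▸ hafin), one_smul]
  have h1 : ρ.fst = μ.withDensity f := by
    rw [Measure.fst, Measure.map_add _ _ measurable_fst, Measure.map_map measurable_fst hdiag,
      Measure.map_smul, Measure.map_fst_prod, smul_smul, htt a hab, ← hP]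
    congr 1
    exact Measure.map_id
  have h2 : ρ.snd = μ := by
    rw [Measure.snd, Measure.map_add _ _ measurable_snd, Measure.map_map measurable_snd hdiag,
      Measure.map_smul, Measure.map_snd_prod, smul_smul, hab, htt b rfl]
    conv_rhs => rw [← hQ]
    congr 1
    exact Measure.map_id
  have h3 := transportCost_le (c := discreteDist) ρ
  rw [h1, h2] at h3
  refine h3.trans ?_
  rw [lintegral_add_measure, lintegral_map measurable_discreteDist hdiag, lintegral_smul_measure]
  simp only [discreteDist_self, lintegral_zero, zero_add, smul_eq_mul]
  calc t⁻¹ * ∫⁻ p, discreteDist p.1 p.2 ∂a.prod b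
      ≤ t⁻¹ * ∫⁻ _, 1 ∂a.prod b := by
        gcongr; exact discreteDist_le_one _ _
    _ = t⁻¹ * t * t := by
        rw [lintegral_one, ← Set.univ_prod_univ, Measure.prod_prod, hab, mul_assoc]
    _ ≤ 1 * t := by gcongr; exact ENNReal.inv_mul_le_one t
    _ = ∫⁻ w, (1 - f w) ∂μ := by rw [one_mul, ← hb]

/-- Pinsker's inequality for a decision between two points, around the fair one. -/
theorem binEntropy_le_sub_sq {p : ℝ} (h0 : 0 ≤ p) (h1 : p ≤ 1) :
    binEntropy p ≤ log 2 - 2 * (p - 2⁻¹) ^ 2 := by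
  -- `F` is concave, as F″ = −(2x−1)²/(x(1−x)), and symmetric about 1/2. Hence it is maximal there,
  -- with value log 2.
  set F : ℝ → ℝ := fun p => binEntropy p + 2 * (p - 2⁻¹) ^ 2 with hF
  have hcont : Continuous F := by simp only [hF]; fun_prop
  have hder : ∀ x ∈ Set.Ioo (0 : ℝ) 1,
      HasDerivAt F (log (1 - x) - log x + 4 * (x - 2⁻¹)) x := by
    intro x hx
    exact ((hasDerivAt_binEntropy hx.1.ne' hx.2.ne).add
      ((((hasDerivAt_id' x).sub_const (2⁻¹ : ℝ)).pow 2).const_mul 2)).congr_deriv (by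
        push_cast; ring)
  have hder2 : ∀ x ∈ Set.Ioo (0 : ℝ) 1,
      HasDerivAt (fun x => log (1 - x) - log x + 4 * (x - 2⁻¹)) (-1 / (1 - x) - 1 / x + 4) x := by
    intro x hx
    exact (((((hasDerivAt_id' x).const_sub 1).log (sub_pos.2 hx.2).ne').sub
      ((hasDerivAt_id' x).log hx.1.ne')).add
      (((hasDerivAt_id' x).sub_const (2⁻¹ : ℝ)).const_mul 4)).congr_deriv (by ring)
  have hconc : ConcaveOn ℝ (Set.Icc 0 1) F := by
    refine concaveOn_of_hasDerivWithinAt2_nonpos (convex_Icc 0 1) hcont.continuousOn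
      (f' := fun x => log (1 - x) - log x + 4 * (x - 2⁻¹))
      (f'' := fun x => -1 / (1 - x) - 1 / x + 4) ?_ ?_ ?_
    · intro x hx; rw [interior_Icc] at hx; exact (hder x hx).hasDerivWithinAt
    · intro x hx; rw [interior_Icc] at hx; exact (hder2 x hx).hasDerivWithinAt
    · intro x hx
      rw [interior_Icc] at hx
      have h1x : 0 < 1 - x := sub_pos.2 hx.2
      have hx0 : 0 < x := hx.1
      have : -1 / (1 - x) - 1 / x + 4 = -((2 * x - 1) ^ 2 / (x * (1 - x))) := by
        field_simp; ring
      rw [this]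
      exact neg_nonpos.2 (by positivity)
  have hsym : F (1 - p) = F p := by simp only [hF, binEntropy_one_sub]; ring
  have h2 := hconc.2 (show p ∈ Set.Icc 0 1 from ⟨h0, h1⟩)
    (show 1 - p ∈ Set.Icc 0 1 from ⟨by linarith, by linarith⟩)
    (show (0 : ℝ) ≤ 2⁻¹ by norm_num) (show (0 : ℝ) ≤ 2⁻¹ by norm_num) (by norm_num)
  have hmid : (2⁻¹ : ℝ) • p + (2⁻¹ : ℝ) • (1 - p) = 2⁻¹ := by simp; ring
  rw [hmid, hsym] at h2
  simp only [hF, smul_eq_mul, binEntropy_two_inv, sub_self] at h2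
  linarith

theorem binEntropy_measureReal (ν : Measure Bool) [IsProbabilityMeasure ν] (b : Bool) :
    binEntropy (ν.real {b}) = boolEntropy ν := by
  cases b
  · rw [measureReal_false, binEntropy_one_sub, boolEntropy]
  · rfl

/-- The variance of |g| is nonnegative. -/
theorem sq_integral_abs_le {α : Type*} [MeasurableSpace α] (μ : Measure α) [IsProbabilityMeasure μ]
    {g : α → ℝ} (hg : Integrable g μ) (hg2 : Integrable (fun x => g x ^ 2) μ) :
    (∫ x, |g x| ∂μ) ^ 2 ≤ ∫ x, g x ^ 2 ∂μ := by
  set c := ∫ x, |g x| ∂μ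
  have h : 0 ≤ ∫ x, (|g x| - c) ^ 2 ∂μ := integral_nonneg fun x => sq_nonneg _
  have e : ∀ x, (|g x| - c) ^ 2 = g x ^ 2 - 2 * c * |g x| + c ^ 2 := fun x => by
    rw [sub_sq, sq_abs]; ring
  simp_rw [e] at h
  have hs : Integrable (fun x => g x ^ 2 - 2 * c * |g x|) μ := hg2.sub (hg.abs.const_mul _)
  rw [integral_add hs (integrable_const _),
    integral_sub hg2 (hg.abs.const_mul _), integral_const_mul] at h
  simp only [integral_const, probReal_univ, one_smul] at h
  change 0 ≤ _ - 2 * c * c + c ^ 2 at h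
  nlinarith

/-- A bound on the transport cost by the information in an observation about a fair decision. -/
theorem two_mul_transportCost_le [StandardBorelSpace 𝒲] (μ : Measure 𝒲)
    [IsProbabilityMeasure μ] (η : Kernel 𝒲 Bool) [IsMarkovKernel η] (b : Bool)
    [IsProbabilityMeasure (μ.withDensity fun w => 2 * η w {b})] :
    2 * transportCost discreteDist (μ.withDensity fun w => 2 * η w {b}) μ ≤
      (2 * ENNReal.ofReal (log 2 - ∫ w, boolEntropy (η w) ∂μ)) ^ (1 / 2 : ℝ) := by
  have hq : Measurable fun w => (η w).real {b} :=
    Kernel.measurable_real η (measurableSet_singleton b)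
  have hη : Measurable fun w => η w {b} := η.measurable_coe (measurableSet_singleton b)
  set g : 𝒲 → ℝ := fun w => 1 - 2 * (η w).real {b} with hgdef
  have hgm : Measurable g := measurable_const.sub (hq.const_mul 2)
  have hgb : ∀ w, |g w| ≤ 1 := fun w => by
    have h0 : 0 ≤ (η w).real {b} := measureReal_nonneg
    have h1 : (η w).real {b} ≤ 1 := measureReal_le_one
    rw [abs_le]; constructor <;> simp only [hgdef] <;> linarith
  have hg : Integrable g μ :=
    .of_bound hgm.aestronglyMeasurable 1 (.of_forall hgb)
  have hg2 : Integrable (fun w => g w ^ 2) μ :=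
    .of_bound (hgm.pow_const 2).aestronglyMeasurable 1 (.of_forall fun w => by
      rw [Real.norm_of_nonneg (sq_nonneg _), ← sq_abs]
      exact pow_le_one₀ (abs_nonneg _) (hgb w))
  have hqi : Integrable (fun w => (η w).real {b}) μ :=
    .of_bound hq.aestronglyMeasurable 1 (.of_forall fun w => by
      rw [Real.norm_of_nonneg measureReal_nonneg]; exact measureReal_le_one)
  -- The function `g` is one minus the density of a probability measure.
  have hg0 : ∫ w, g w ∂μ = 0 := by
    have h1 : ∫⁻ w, 2 * η w {b} ∂μ = 1 := by
      have := measure_univ (μ := μ.withDensity fun w => 2 * η w {b})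
      rwa [withDensity_apply _ MeasurableSet.univ, Measure.restrict_univ] at this
    have h2 : ∫ w, 2 * (η w).real {b} ∂μ = 1 := by
      rw [integral_eq_lintegral_of_nonneg_ae (.of_forall fun w => by positivity)
        (hq.const_mul 2).aestronglyMeasurable]
      have : ∀ w, ENNReal.ofReal (2 * (η w).real {b}) = 2 * η w {b} := fun w => by
        rw [ENNReal.ofReal_mul zero_le_two, ofReal_measureReal]; simp
      simp_rw [this, h1]
      simp
    simp only [hgdef]
    rw [integral_sub (integrable_const _) (hqi.const_mul 2), h2]
    simp
  -- As `g` has mean zero, its positive part carries half of ∫ |g|; this absorbs the factor 2 on the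
  -- left.
  have hlin : 2 * ∫⁻ w, (1 - 2 * η w {b}) ∂μ = ENNReal.ofReal (∫ w, |g w| ∂μ) := by
    have e1 : ∀ w, 1 - 2 * η w {b} = ENNReal.ofReal ((g w + |g w|) / 2) := fun w => by
      have : (g w + |g w|) / 2 = max (g w) 0 := by
        rcases le_total (g w) 0 with h | h
        · rw [abs_of_nonpos h, max_eq_right h]; ring
        · rw [abs_of_nonneg h, max_eq_left h]; ring
      rw [this, ENNReal.ofReal_max, ENNReal.ofReal_zero, max_eq_left zero_le,
        hgdef, ENNReal.ofReal_sub _ (by positivity), ENNReal.ofReal_mul zero_le_two,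
        ofReal_measureReal]
      simp
    simp_rw [e1]
    have hi : Integrable (fun w => (g w + |g w|) / 2) μ := (hg.add hg.abs).div_const 2
    rw [← ofReal_integral_eq_lintegral_ofReal hi (.of_forall fun w => by
        have := neg_abs_le (g w)
        simp only [Pi.zero_apply]
        linarith), integral_div, integral_add hg hg.abs, hg0,
      show (2 : ℝ≥0∞) = ENNReal.ofReal 2 by simp, ← ENNReal.ofReal_mul zero_le_two]
    congr 1
    ring
  -- With q the probability of `b`, g² = 4(q − 1/2)², so the binary Pinsker inequality gives g² ≤
  -- 2(log 2 − h(q)) pointwise.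
  have hpin : (∫ w, |g w| ∂μ) ^ 2 ≤ 2 * (log 2 - ∫ w, boolEntropy (η w) ∂μ) := by
    have hi := integrable_boolEntropy η μ
    have e : 2 * (log 2 - ∫ w, boolEntropy (η w) ∂μ) =
        ∫ w, 2 * (log 2 - boolEntropy (η w)) ∂μ := by
      rw [integral_const_mul, integral_sub (integrable_const _) hi]
      simp
    rw [e]
    refine (sq_integral_abs_le μ hg hg2).trans
      (integral_mono hg2 (((integrable_const _).sub hi).const_mul 2) fun w => ?_)
    have := binEntropy_le_sub_sq (p := (η w).real {b}) measureReal_nonneg measureReal_le_one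
    rw [binEntropy_measureReal] at this
    simp only [hgdef]
    nlinarith
  calc 2 * transportCost discreteDist (μ.withDensity fun w => 2 * η w {b}) μ
      ≤ 2 * ∫⁻ w, (1 - 2 * η w {b}) ∂μ := by
        gcongr; exact transportCost_discreteDist_le μ (hη.const_mul 2)
    _ = ENNReal.ofReal (∫ w, |g w| ∂μ) := hlin
    _ = (ENNReal.ofReal ((∫ w, |g w| ∂μ) ^ 2)) ^ (1 / 2 : ℝ) := by
        rw [ENNReal.ofReal_rpow_of_nonneg (sq_nonneg _) (by norm_num), ← Real.sqrt_eq_rpow,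
          Real.sqrt_sq (integral_nonneg fun _ => abs_nonneg _)]
    _ ≤ _ := by
        refine ENNReal.rpow_le_rpow ?_ (by norm_num)
        rw [show (2 : ℝ≥0∞) = ENNReal.ofReal 2 by simp, ← ENNReal.ofReal_mul zero_le_two]
        exact ENNReal.ofReal_le_ofReal hpin

variable {γ Ω : Type*} [MeasurableSpace γ] [MeasurableSpace Ω] [StandardBorelSpace 𝒲]
  [Nonempty 𝒲] {U : Ω → Bool} {Z : Ω → γ} {W : Ω → 𝒲} {P : Measure Ω} [IsProbabilityMeasure P]

theorem IsFairGiven.two_mul_lintegral_transportCost_le (h : IsFairGiven U Z P) (hU : Measurable U)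
    (hZ : Measurable Z) (hW : Measurable W) :
    2 * ∫⁻ ω, transportCost discreteDist (condDistrib W (fun ω => (Z ω, U ω)) P (Z ω, U ω))
        (condDistrib W Z P (Z ω)) ∂P ≤
      ∫⁻ ω, (2 * condMutualInfoAt W U Z P (Z ω)) ^ (1 / 2 : ℝ) ∂P := by
  rw [← lintegral_const_mul' _ _ (by simp)]
  refine lintegral_mono_ae ?_
  filter_upwards [ae_of_ae_map hZ.aemeasurable (h.condDistrib_eq_withDensity hU hZ hW),
    ae_of_ae_map hZ.aemeasurable (condMutualInfoAt_ae_eq (P := P) hW hU hZ),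
    ae_of_ae_map hZ.aemeasurable (h.condDistrib_ae_eq hU)] with ω h1 h2 h3
  rw [h2, h3, Kernel.const_apply, boolEntropy_fairCoin, h1]
  have : IsProbabilityMeasure ((condDistrib W Z P (Z ω)).withDensity fun w =>
      2 * (condDistrib U (fun ω => (Z ω, W ω)) P).sectR (Z ω) w {U ω}) :=
    h1 (U ω) ▸ inferInstance
  exact two_mul_transportCost_le (condDistrib W Z P (Z ω))
    ((condDistrib U (fun ω => (Z ω, W ω)) P).sectR (Z ω)) (U ω)

end Transport

/-! ### The supersample -/

section SuperLaw

variable {n : ℕ → ℕ} {L : ℕ} {E : ℕ → Type u} [∀ l, MeasurableSpace (E l)] {𝒲 : Type v}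
  [MeasurableSpace 𝒲]

theorem measurable_selectedTree_update (ν : ProperNode n L) (b : Bool) :
    Measurable fun q : SampleTree (Doubled n) E L × Decisions n L =>
      selectedTree (Function.update q.2 ν b) q.1 :=
  measurable_selectedTree.comp (measurable_fst.prodMk
    ((measurable_of_finite fun U : Decisions n L => Function.update U ν b).comp measurable_snd))

theorem measurable_nodePair (ν : ProperNode n L) :
    Measurable (nodePair ν : SuperSpace n L E 𝒲 → _) :=
  measurable_pi_iff.2 fun b => (measurable_pi_apply ν.2).comp ((measurable_pi_apply ν.1.succ).comp
    ((measurable_selectedTree_update ν b).comp measurable_fst))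

theorem measurable_leafPair (ν : ProperNode n L) :
    Measurable (leafPair ν : SuperSpace n L E 𝒲 → _) :=
  measurable_pi_iff.2 fun b => measurable_pi_iff.2 fun j => (measurable_pi_apply j.1).comp
    (measurable_leaves.comp ((measurable_selectedTree_update ν b).comp measurable_fst))

theorem measurable_decision (ν : ProperNode n L) :
    Measurable (decision ν : SuperSpace n L E 𝒲 → _) :=
  (measurable_pi_apply ν).comp (measurable_snd.comp measurable_fst)

theorem measurable_hypothesis : Measurable (hypothesis : SuperSpace n L E 𝒲 → _) :=
  measurable_snd

variable (root : E 0) (K : ∀ l, Kernel (E l) (E (l + 1))) [∀ l, IsMarkovKernel (K l)]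
  (A : Kernel (SampleTree (Branch n) E L) 𝒲) [IsMarkovKernel A]

/-- The law of independent fair decisions. -/
noncomputable abbrev decisionLaw (n : ℕ → ℕ) (L : ℕ) : Measure (Decisions n L) :=
  Measure.pi fun _ : ProperNode n L => fairCoin

/-- The joint law of the supersample and the decisions. -/
noncomputable abbrev baseLaw (n : ℕ → ℕ) (L : ℕ) :
    Measure (SampleTree (Doubled n) E L × Decisions n L) :=
  (treeLaw (Doubled n) root K L).prod (decisionLaw n L)

theorem superLaw_map_fst : (superLaw root K A).map Prod.fst = baseLaw root K n L :=
  Measure.fst_compProd _ _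

/-- One coordinate of a product measure may be redrawn independently. -/
theorem lintegral_decisionLaw_update (ν : ProperNode n L) (f : Decisions n L → ℝ≥0∞) :
    ∫⁻ U, f U ∂decisionLaw n L =
      ∫⁻ U, ∫⁻ b, f (Function.update U ν b) ∂fairCoin ∂decisionLaw n L := by
  classical
  have hm : ∀ g : Decisions n L → ℝ≥0∞, Measurable g := fun g => measurable_of_finite g
  have h := pi_prod_map_merge (· = ν) (fun _ => fairCoin) (fun _ : ProperNode n L => fairCoin)
  simp only [ite_self] at h
  rw [decisionLaw, ← h, lintegral_map (hm f) (measurable_merge _), h,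
    lintegral_prod_symm _ (measurable_of_finite _).aemeasurable]
  refine lintegral_congr fun U => ?_
  rw [← (measurePreserving_eval (fun _ : ProperNode n L => fairCoin) ν).lintegral_comp
    (measurable_of_finite _)]
  refine lintegral_congr fun U' => congrArg f ?_
  funext ν'
  by_cases h' : ν' = ν
  · subst h'; simp
  · simp [h']

theorem isFairGiven_decision (ν : ProperNode n L) {γ : Type*} [MeasurableSpace γ]
    {G : SampleTree (Doubled n) E L × Decisions n L → γ} (hG : Measurable G)
    (hν : ∀ T U b, G (T, Function.update U ν b) = G (T, U)) :
    IsFairGiven (decision ν) (fun ω => G ω.1) (superLaw root K A) := by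
  have hd : Measurable fun q : SampleTree (Doubled n) E L × Decisions n L => q.2 ν := by fun_prop
  have e1 : (superLaw root K A).map (fun ω => (G ω.1, decision ν ω)) =
      (baseLaw root K n L).map fun q => (G q, q.2 ν) := by
    rw [← superLaw_map_fst root K A, Measure.map_map (hG.prodMk hd) measurable_fst]; rfl
  have e2 : (superLaw root K A).map (fun ω => G ω.1) = (baseLaw root K n L).map G := by
    rw [← superLaw_map_fst root K A, Measure.map_map hG measurable_fst]; rfl
  rw [IsFairGiven, e1, e2]
  refine Measure.ext_of_lintegral _ fun f hf => ?_
  rw [lintegral_map hf (hG.prodMk hd), lintegral_prod _ hf.aemeasurable,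
    lintegral_map hf.lintegral_prod_right' hG,
    lintegral_prod (fun q => f (G q, q.2 ν)) (hf.comp (hG.prodMk hd)).aemeasurable,
    lintegral_prod (fun q => ∫⁻ y, f (G q, y) ∂fairCoin)
      (hf.lintegral_prod_right'.comp hG).aemeasurable]
  refine lintegral_congr fun T => ?_
  rw [lintegral_decisionLaw_update ν]
  simp [hν]

/-- Both pairs are listed by label: the decision at ν is overwritten before they are read, so they
do not depend on it. -/
theorem isFairGiven_pairs (ν : ProperNode n L) :
    IsFairGiven (decision ν) (fun ω => (nodePair ν ω, leafPair ν ω)) (superLaw root K A) :=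
  isFairGiven_decision root K A ν
    (G := fun q => ((fun b => selectedTree (Function.update q.2 ν b) q.1 ν.1.succ ν.2 :
        Bool → E (ν.1 + 1)),
      (fun b j => (selectedTree (Function.update q.2 ν b) q.1).leaves j.1 :
        Bool → LeafBelow ν → E L)))
    ((measurable_pi_iff.2 fun b => (measurable_pi_apply ν.2).comp
      ((measurable_pi_apply ν.1.succ).comp (measurable_selectedTree_update ν b))).prodMk
      (measurable_pi_iff.2 fun b => measurable_pi_iff.2 fun j => (measurable_pi_apply j.1).comp
        (measurable_leaves.comp (measurable_selectedTree_update ν b))))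
    fun T U b => by simp only [Function.update_idem]

theorem isFairGiven_leafPair (ν : ProperNode n L) :
    IsFairGiven (decision ν) (leafPair ν) (superLaw root K A) :=
  (isFairGiven_pairs root K A ν).comp (measurable_decision ν)
    ((measurable_nodePair ν).prodMk (measurable_leafPair ν)) measurable_snd

theorem treeLaw_map_selectedTree (U : Decisions n L) :
    (treeLaw (Doubled n) root K L).map (selectedTree U) = treeLaw (Branch n) root K L := by
  rw [← treeLaw_map_pullback (C := Doubled n) (C' := Branch n) root K
    -- The embedding must be defined at every depth, but decisions exist only for the nodes of the
    -- tree; the value `true` beyond depth `L` is never read.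
    (fun l j k => (j k, if h : (k : ℕ) < L then U ⟨⟨k, h⟩, j.ancestor k.2⟩ else true))]
  · congr 1
    funext T l j
    refine congrArg (T l) (funext fun k => ?_)
    simp only [selectedIndex]
    rw [dif_pos (k.2.trans_le (Nat.lt_succ_iff.1 l.2))]
  · intro l j j' h
    funext k
    exact congrArg Prod.fst (congrFun h k)
  · intro l p
    rfl

end SuperLaw

/-! ### Generalization error of a difference of means -/

section MeanDifference

variable {γ Ω : Type*} {𝒲 : Type*} [MeasurableSpace 𝒲] [MeasurableSpace γ] [MeasurableSpace Ω]
  [StandardBorelSpace 𝒲] [Nonempty 𝒲] {U : Ω → Bool} {Z : Ω → γ} {W : Ω → 𝒲} {P : Measure Ω}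
  [IsProbabilityMeasure P]

/-- The sign of a decision. -/
def boolSign (b : Bool) : ℝ := if b then 1 else -1

theorem abs_boolSign (b : Bool) : |boolSign b| = 1 := by cases b <;> simp [boolSign]

theorem measurable_boolSign : Measurable boolSign := measurable_of_finite _

theorem integral_boolSign : ∫ b, boolSign b ∂fairCoin = 0 := by
  rw [integral_bool, measureReal_def, measureReal_def, fairCoin_singleton, fairCoin_singleton]
  simp [boolSign]

/-- If the decision `U` is fair given `Z`, then the mean of `± G (Z, W)`, with the sign given by
`U`, is controlled by the dependence of `W` on `U` given `Z`. -/
theorem IsFairGiven.ofReal_integral_le (h : IsFairGiven U Z P) (hU : Measurable U)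
    (hZ : Measurable Z) (hW : Measurable W) {c : 𝒲 → 𝒲 → ℝ≥0∞} {a : ℝ≥0∞} (ha : a ≠ ∞)
    {G : γ × 𝒲 → ℝ} (hG : Measurable G) (hint : Integrable (fun ω => G (Z ω, W ω)) P)
    (hc : ∀ z w w', ENNReal.ofReal |G (z, w) - G (z, w')| ≤ a * c w w') :
    ENNReal.ofReal (∫ ω, boolSign (U ω) * G (Z ω, W ω) ∂P) ≤
      a * ∫⁻ ω, transportCost c (condDistrib W (fun ω => (Z ω, U ω)) P (Z ω, U ω))
        (condDistrib W Z P (Z ω)) ∂P := by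
  have hZU : Measurable fun ω => (Z ω, U ω) := hZ.prodMk hU
  set g : (γ × Bool) × 𝒲 → ℝ := fun q => boolSign q.1.2 * G (q.1.1, q.2) with hgdef
  have hg : Measurable g := (measurable_boolSign.comp (by fun_prop)).mul (hG.comp (by fun_prop))
  have hi1 : Integrable (fun ω => g ((Z ω, U ω), W ω)) P := by
    refine (integrable_norm_iff (hg.comp (hZU.prodMk hW)).aestronglyMeasurable).1 ?_
    refine hint.norm.congr (.of_forall fun ω => ?_)
    simp [hgdef, abs_boolSign]
  have hi1' : Integrable g (P.map (fun ω => (Z ω, U ω)) ⊗ₘ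
      condDistrib W (fun ω => (Z ω, U ω)) P) := by
    rw [compProd_map_condDistrib hW.aemeasurable]
    exact (integrable_map_measure hg.aestronglyMeasurable (hZU.prodMk hW).aemeasurable).2 hi1
  have hi2' : Integrable G (P.map Z ⊗ₘ condDistrib W Z P) := by
    rw [compProd_map_condDistrib hW.aemeasurable]
    exact (integrable_map_measure hG.aestronglyMeasurable (hZ.prodMk hW).aemeasurable).2 hint
  set h1 : Ω → ℝ := fun ω =>
    ∫ w, g ((Z ω, U ω), w) ∂condDistrib W (fun ω => (Z ω, U ω)) P (Z ω, U ω)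
  -- The mean of the signed difference when W is redrawn from its law given Z alone. The sign then
  -- factors out as a fair coin independent of Z, so the expectation of `h2` is zero and may be
  -- subtracted for free.
  set h2 : Ω → ℝ := fun ω => ∫ w, g ((Z ω, U ω), w) ∂condDistrib W Z P (Z ω)
  set m : γ → ℝ := fun z => ∫ w, G (z, w) ∂condDistrib W Z P z
  have hmi : Integrable m (P.map Z) := by simpa using hi2'.integral_compProd
  have hh1 : Integrable h1 P := by
    have : Integrable (fun q => ∫ w, g (q, w) ∂condDistrib W (fun ω => (Z ω, U ω)) P q)
      (P.map fun ω => (Z ω, U ω)) := by simpa using hi1'.integral_compProd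
    exact this.comp_measurable hZU
  have e1 : ∫ ω, boolSign (U ω) * G (Z ω, W ω) ∂P = ∫ ω, h1 ω ∂P := by
    have s1 : ∫ ω, g ((Z ω, U ω), W ω) ∂P = ∫ q, g q ∂(P.map (fun ω => (Z ω, U ω)) ⊗ₘ
        condDistrib W (fun ω => (Z ω, U ω)) P) := by
      rw [compProd_map_condDistrib hW.aemeasurable]
      exact (integral_map (hZU.prodMk hW).aemeasurable hg.aestronglyMeasurable).symm
    refine s1.trans ?_
    rw [Measure.integral_compProd hi1']
    have : AEStronglyMeasurable (fun q => ∫ w, g (q, w) ∂condDistrib W (fun ω => (Z ω, U ω)) P q)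
      (P.map fun ω => (Z ω, U ω)) := by
      have := hi1'.integral_compProd
      simp at this
      exact this.aestronglyMeasurable
    exact integral_map hZU.aemeasurable this
  have e2 : h2 = fun ω => boolSign (U ω) * m (Z ω) := by
    funext ω
    simp only [h2, hgdef, m]
    rw [integral_const_mul]
  have hprod : Integrable (fun q : γ × Bool => m q.1 * boolSign q.2) ((P.map Z).prod fairCoin) :=
    hmi.mul_prod .of_finite
  have hP := Measure.isProbabilityMeasure_map (μ := P) hZ.aemeasurable
  have hh2 : Integrable h2 P := by
    rw [e2]
    rw [← h] at hprod
    exact (hprod.comp_measurable hZU).congr (.of_forall fun ω => mul_comm _ _)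
  have e3 : ∫ ω, h2 ω ∂P = 0 := by
    rw [e2]
    have : ∫ q, m q.1 * boolSign q.2 ∂(P.map fun ω => (Z ω, U ω)) =
        ∫ ω, m (Z ω) * boolSign (U ω) ∂P :=
      integral_map hZU.aemeasurable (h ▸ hprod.aestronglyMeasurable)
    simp_rw [mul_comm (boolSign _)]
    rw [← this, h, integral_prod_mul, integral_boolSign, mul_zero]
  have hae1 : ∀ᵐ ω ∂P, Integrable (fun w => g ((Z ω, U ω), w))
      (condDistrib W (fun ω => (Z ω, U ω)) P (Z ω, U ω)) :=
    ae_of_ae_map hZU.aemeasurable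
      ((Measure.integrable_compProd_iff hg.aestronglyMeasurable).1 hi1').1
  have hae2 : ∀ᵐ ω ∂P, Integrable (fun w => g ((Z ω, U ω), w)) (condDistrib W Z P (Z ω)) := by
    filter_upwards [ae_of_ae_map hZ.aemeasurable
      ((Measure.integrable_compProd_iff hG.aestronglyMeasurable).1 hi2').1] with ω hω
    exact hω.const_mul (boolSign (U ω))
  calc ENNReal.ofReal (∫ ω, boolSign (U ω) * G (Z ω, W ω) ∂P)
      = ENNReal.ofReal (∫ ω, (h1 ω - h2 ω) ∂P) := by
        rw [integral_sub hh1 hh2, e3, sub_zero, e1]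
    _ ≤ ∫⁻ ω, ENNReal.ofReal (h1 ω - h2 ω) ∂P := ofReal_integral_le_lintegral (hh1.sub hh2)
    _ ≤ ∫⁻ ω, a * transportCost c (condDistrib W (fun ω => (Z ω, U ω)) P (Z ω, U ω))
        (condDistrib W Z P (Z ω)) ∂P := by
        refine lintegral_mono_ae ?_
        filter_upwards [hae1, hae2] with ω hω1 hω2
        refine ofReal_integral_sub_le_transportCost ha hω1 hω2 fun w w' => ?_
        refine le_trans (ENNReal.ofReal_le_ofReal ?_) (hc (Z ω) w w')
        simp only [hgdef]
        rw [← mul_sub]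
        refine (le_abs_self _).trans ?_
        rw [abs_mul, abs_boolSign, one_mul]
    _ = _ := lintegral_const_mul' _ _ ha

end MeanDifference

/-! ### The bound on the generalization error -/

section GenBound

variable {n : ℕ → ℕ} {E : ℕ → Type u} [∀ l, MeasurableSpace (E l)] {𝒲 : Type v}
  [MeasurableSpace 𝒲]

/-- The first-level ancestor of a leaf. -/
def topNode {L : ℕ} (j : NodeIndex (Branch n) (L + 1)) : ProperNode n (L + 1) :=
  ⟨⟨0, L.succ_pos⟩, j.ancestor (Nat.succ_le_succ L.zero_le)⟩

/-- The position of the ghost leaf below the ghost copy of the first-level ancestor of `j`. -/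
def ghostIndex {L : ℕ} (U : Decisions n (L + 1)) (j : NodeIndex (Branch n) (L + 1)) :
    NodeIndex (Doubled n) (L + 1) :=
  selectedIndex (Function.update U (topNode j) (!U (topNode j))) le_rfl j

variable (root : E 0) (K : ∀ l, Kernel (E l) (E (l + 1))) [∀ l, IsMarkovKernel (K l)]

/-- The ghost leaf is an independent leaf. -/
theorem treeLaw_map_selectedTree_ghost {L : ℕ} (U : Decisions n (L + 1))
    (j : NodeIndex (Branch n) (L + 1)) :
    (treeLaw (Doubled n) root K (L + 1)).map
        (fun T => (selectedTree U T, T.leaves (ghostIndex U j))) =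
      (treeLaw (Branch n) root K (L + 1)).prod (chainLaw root K (L + 1)) := by
  have hs : Measurable (selectedTree U : SampleTree (Doubled n) E (L + 1) → _) :=
    measurable_selectedTree.comp (measurable_id.prodMk measurable_const)
  have hl : Measurable fun T : SampleTree (Doubled n) E (L + 1) => T.leaves (ghostIndex U j) :=
    (measurable_pi_apply _).comp measurable_leaves
  -- The single branch at the ghost copy of the first-level ancestor. The selected tree avoids it
  -- and the ghost leaf lies in it, so after merging they read two independent samples.
  let S : Set (Doubled n 0) := {c | c = (j ⟨0, L.succ_pos⟩, !U (topNode j))}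
  have hm := SampleTree.measurable_merge (L := L + 1) (E := E) (C := Doubled n) S
  rw [← treeLaw_prod_map_merge (C := Doubled n) root K S,
    Measure.map_map (hs.prodMk hl) hm]
  have : (fun T : SampleTree (Doubled n) E (L + 1) =>
        (selectedTree U T, T.leaves (ghostIndex U j))) ∘ SampleTree.merge S =
      Prod.map (selectedTree U) (fun T => T.leaves (ghostIndex U j)) ∘ Prod.swap := by
    funext q
    refine Prod.ext ?_ ?_
    · funext l i
      refine if_neg ?_
      rintro ⟨h, h'⟩
      have h1 : i ⟨0, h⟩ = j ⟨0, L.succ_pos⟩ := congrArg Prod.fst h'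
      have h2 : U ⟨⟨0, h.trans_le (Nat.lt_succ_iff.1 l.2)⟩, i.ancestor h⟩ = !U (topNode j) :=
        congrArg Prod.snd h'
      have : topNode j = ⟨⟨0, h.trans_le (Nat.lt_succ_iff.1 l.2)⟩, i.ancestor h⟩ := by
        refine Sigma.ext rfl (heq_of_eq ?_)
        funext k
        obtain rfl : k = 0 := Fin.eq_zero k
        exact h1.symm
      rw [this] at h2
      cases U ⟨⟨0, h.trans_le (Nat.lt_succ_iff.1 l.2)⟩, i.ancestor h⟩ <;> simp at h2
    · have h2 : (ghostIndex U j ⟨0, L.succ_pos⟩).2 = !U (topNode j) := by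
        change Function.update U (topNode j) (!U (topNode j)) (topNode j) = _
        rw [Function.update_self]
      exact if_pos ⟨L.succ_pos, Prod.ext rfl h2⟩
  rw [this, ← Measure.map_map (hs.prodMap hl) measurable_swap, Measure.prod_swap,
    ← Measure.map_prod_map _ _ hs hl, treeLaw_map_selectedTree, treeLaw_map_leaf]

variable {L : ℕ} (A : Kernel (SampleTree (Branch n) E (L + 1)) 𝒲) [IsMarkovKernel A]

theorem measurable_ghostLeaf (j : NodeIndex (Branch n) (L + 1)) :
    Measurable fun q : SampleTree (Doubled n) E (L + 1) × Decisions n (L + 1) =>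
      q.1.leaves (ghostIndex q.2 j) :=
  measurable_from_prod_countable_left fun U =>
    show Measurable fun T : SampleTree (Doubled n) E (L + 1) => T.leaves (ghostIndex U j) from
      (measurable_pi_apply _).comp measurable_leaves

/-- For every fixed value of the decisions, the selected tree and the ghost leaf have the same joint
law, so averaging over decisions changes nothing; the algorithm sees only the selected tree. -/
theorem superLaw_map_selectedTree_ghost (j : NodeIndex (Branch n) (L + 1)) :
    (superLaw root K A).map (Prod.map
        (fun q => (selectedTree q.2 q.1, q.1.leaves (ghostIndex q.2 j))) id) =
      ((treeLaw (Branch n) root K (L + 1)).prod (chainLaw root K (L + 1))) ⊗ₘ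
        A.comap Prod.fst measurable_fst := by
  have hr := (measurable_selectedTree (n := n) (E := E) (L := L + 1)).prodMk
    (measurable_ghostLeaf j)
  rw [superLaw, compProd_map_prodMap _ _ hr measurable_id (A.comap Prod.fst measurable_fst)]
  · congr 1
    refine Measure.ext_of_lintegral _ fun f hf => ?_
    rw [lintegral_map hf hr, lintegral_prod_symm (fun q =>
      f (selectedTree q.2 q.1, q.1.leaves (ghostIndex q.2 j))) (hf.comp hr).aemeasurable]
    have : ∀ U : Decisions n (L + 1), ∫⁻ T, f (selectedTree U T, T.leaves (ghostIndex U j))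
        ∂treeLaw (Doubled n) root K (L + 1) =
        ∫⁻ q, f q ∂(treeLaw (Branch n) root K (L + 1)).prod (chainLaw root K (L + 1)) := by
      intro U
      rw [← treeLaw_map_selectedTree_ghost root K U j, lintegral_map hf]
      exact hr.comp measurable_prodMk_right
    simp [this]
  · intro q
    rw [Measure.map_id]
    rfl

/-- The hypothesis and the ghost leaf are independent. -/
theorem superLaw_map_hypothesis_ghost [IsProbabilityMeasure (chainLaw root K (L + 1))]
    (j : NodeIndex (Branch n) (L + 1)) :
    (superLaw root K A).map (fun ω => (ω.2, ω.1.1.leaves (ghostIndex ω.1.2 j))) =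
      (A ∘ₘ treeLaw (Branch n) root K (L + 1)).prod (chainLaw root K (L + 1)) := by
  have hr := (measurable_selectedTree (n := n) (E := E) (L := L + 1)).prodMk
    (measurable_ghostLeaf j)
  have hp : Measurable fun p : (SampleTree (Branch n) E (L + 1) × E (L + 1)) × 𝒲 =>
    (p.2, p.1.2) := by fun_prop
  have : (superLaw root K A).map (fun ω => (ω.2, ω.1.1.leaves (ghostIndex ω.1.2 j))) =
      ((superLaw root K A).map (Prod.map
        (fun q => (selectedTree q.2 q.1, q.1.leaves (ghostIndex q.2 j))) id)).map
        fun p => (p.2, p.1.2) := by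
    rw [Measure.map_map hp (hr.prodMap measurable_id)]; rfl
  rw [this, superLaw_map_selectedTree_ghost]
  refine Measure.ext_of_lintegral _ fun f hf => ?_
  rw [lintegral_map hf hp, Measure.lintegral_compProd (f := fun p : (SampleTree (Branch n) E (L + 1) × E (L + 1)) × 𝒲 =>
      f (p.2, p.1.2)) (hf.comp hp),
    lintegral_prod_symm (fun q => ∫⁻ w, f (w, q.2) ∂A.comap Prod.fst measurable_fst q)
      (Measurable.aemeasurable (Measurable.lintegral_kernel_prod_right'
      (κ := A.comap Prod.fst measurable_fst) (f := fun q => f (q.2, q.1.2)) (hf.comp hp))),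
    lintegral_prod_symm _ hf.aemeasurable]
  refine lintegral_congr fun z => ?_
  rw [Measure.lintegral_bind (f := fun w => f (w, z)) A.aemeasurable
    (hf.comp measurable_prodMk_right).aemeasurable]
  rfl

theorem superLaw_map_selectedTree :
    (superLaw root K A).map (fun ω => (selectedTree ω.1.2 ω.1.1, ω.2)) =
      treeLaw (Branch n) root K (L + 1) ⊗ₘ A := by
  have hs := measurable_selectedTree (n := n) (E := E) (L := L + 1)
  have h := compProd_map_prodMap (baseLaw root K n (L + 1))
    (A.comap (fun p => selectedTree p.2 p.1) hs) hs measurable_id A (fun a => by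
      rw [Measure.map_id]; rfl)
  refine h.trans ?_
  congr 1
  refine Measure.ext_of_lintegral _ fun f hf => ?_
  rw [lintegral_map hf hs, lintegral_prod_symm (fun q => f (selectedTree q.2 q.1))
    (hf.comp hs).aemeasurable]
  have : ∀ U : Decisions n (L + 1), ∫⁻ T, f (selectedTree U T)
      ∂treeLaw (Doubled n) root K (L + 1) = ∫⁻ T, f T ∂treeLaw (Branch n) root K (L + 1) := by
    intro U
    rw [← treeLaw_map_selectedTree root K U, lintegral_map hf]
    exact hs.comp measurable_prodMk_right
  simp [this]

/-! ### Averages over leaves and levels, and the bound on the error -/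

instance isProbabilityMeasure_chainLaw (l : ℕ) : IsProbabilityMeasure (chainLaw root K l) := by
  induction l with
  | zero => unfold chainLaw; infer_instance
  | succ l ih => unfold chainLaw; infer_instance

theorem card_nodeIndex (n : ℕ → ℕ) (l : ℕ) :
    Fintype.card (NodeIndex (Branch n) l) = levelSize n l := by
  rw [Fintype.card_pi, levelSize, ← Fin.prod_univ_eq_prod_range]
  simp

theorem levelSize_pos (L : ℕ) (hn : ∀ k < L, 0 < n k) : 0 < levelSize n L :=
  Finset.prod_pos fun k hk => hn k (Finset.mem_range.1 hk)

/-- The mean over the leaves of a quantity that depends on the first-level ancestor is the mean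
over the first level. -/
theorem mean_leaves_eq_mean_level_one (L : ℕ) (hn : ∀ k < L + 1, 0 < n k)
    (F : ProperNode n (L + 1) → ℝ≥0∞) :
    (levelSize n (L + 1) : ℝ≥0∞)⁻¹ * ∑ j : NodeIndex (Branch n) (L + 1), F (topNode j) =
      (levelSize n 1 : ℝ≥0∞)⁻¹ * ∑ i : NodeIndex (Branch n) 1, F ⟨⟨0, L.succ_pos⟩, i⟩ := by
  -- `M` is the number of leaves below each first-level node; it cancels against the same factor in
  -- the number of leaves.
  set M := Fintype.card (∀ k : Fin L, Branch n (k.succ : Fin (L + 1))) with hM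
  have e1 : ∑ j : NodeIndex (Branch n) (L + 1), F (topNode j) =
      M * ∑ i : Fin (n 0), F ⟨⟨0, L.succ_pos⟩, fun k => Fin.cast (by rw [Fin.eq_zero k]; rfl) i⟩ := by
    rw [← (Fin.consEquiv fun k : Fin (L + 1) => Branch n k).sum_comp, Fintype.sum_prod_type,
      Finset.mul_sum]
    refine Finset.sum_congr rfl fun i _ => ?_
    have : ∀ r : (∀ k : Fin L, Branch n (k.succ : Fin (L + 1))),
        F (topNode ((Fin.consEquiv fun k : Fin (L + 1) => Branch n k) (i, r))) =
        F ⟨⟨0, L.succ_pos⟩, fun k => Fin.cast (by rw [Fin.eq_zero k]; rfl) i⟩ := by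
      intro r
      congr 1
      refine Sigma.ext rfl (heq_of_eq ?_)
      funext k
      obtain rfl : k = 0 := Fin.eq_zero k
      rfl
    rw [Finset.sum_congr rfl fun r _ => this r]
    simp [hM]
  have e2 : ∑ i : NodeIndex (Branch n) 1, F ⟨⟨0, L.succ_pos⟩, i⟩ =
      ∑ i : Fin (n 0), F ⟨⟨0, L.succ_pos⟩, fun k => Fin.cast (by rw [Fin.eq_zero k]; rfl) i⟩ := by
    refine Fintype.sum_equiv (Equiv.piUnique fun k : Fin 1 => Branch n k) _ _ fun i => ?_
    congr 1
    refine Sigma.ext rfl (heq_of_eq ?_)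
    funext k
    obtain rfl : k = 0 := Fin.eq_zero k
    rfl
  have hN : levelSize n (L + 1) = M * levelSize n 1 := by
    rw [← card_nodeIndex, ← card_nodeIndex,
      ← Fintype.card_congr (Fin.consEquiv fun k : Fin (L + 1) => Branch n k), Fintype.card_prod,
      Fintype.card_congr (Equiv.piUnique fun k : Fin 1 => Branch n k), mul_comm]
    rfl
  have hpos := levelSize_pos (L + 1) hn
  have hM0 : M ≠ 0 := by
    rintro h; rw [hN, h, zero_mul] at hpos; exact lt_irrefl _ hpos
  have hM0' : (M : ℝ≥0∞) ≠ 0 := by exact_mod_cast hM0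
  rw [e1, e2, hN, Nat.cast_mul, ENNReal.mul_inv (.inl hM0') (.inl (by simp)), mul_assoc,
    mul_left_comm _ (M : ℝ≥0∞), ← mul_assoc (M : ℝ≥0∞)⁻¹, ENNReal.inv_mul_cancel hM0' (by simp),
    one_mul]

theorem mean_level_one_le_sumOfLevelMeans (L : ℕ) (F : ProperNode n (L + 1) → ℝ≥0∞) :
    (levelSize n 1 : ℝ≥0∞)⁻¹ * ∑ i : NodeIndex (Branch n) 1, F ⟨⟨0, L.succ_pos⟩, i⟩ ≤ sumOfLevelMeans F := by
  rw [sumOfLevelMeans, Fin.sum_univ_succ]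
  exact le_self_add

variable [StandardBorelSpace 𝒲] [Nonempty 𝒲]

/-- Each leaf is paired with the ghost leaf below its first-level ancestor, so only first-level
terms of the sum are used. -/
theorem genError_le_succ (hn : ∀ k < L + 1, 0 < n k) (ℓ : 𝒲 → E (L + 1) → ℝ)
    (hℓ : Measurable (Function.uncurry ℓ))
    (hint : Integrable (Function.uncurry ℓ)
      ((A ∘ₘ treeLaw (Branch n) root K (L + 1)).prod (chainLaw root K (L + 1))))
    (hintj : ∀ j, Integrable (fun p : SampleTree (Branch n) E (L + 1) × 𝒲 => ℓ p.2 (p.1.leaves j))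
      (treeLaw (Branch n) root K (L + 1) ⊗ₘ A))
    {c : 𝒲 → 𝒲 → ℝ≥0∞} {a : ℝ≥0∞} (ha : a ≠ ∞)
    (hc : ∀ z w w', ENNReal.ofReal |ℓ w z - ℓ w' z| ≤ a * c w w') :
    ENNReal.ofReal (genError root K A ℓ) ≤
      2 * a * sumOfLevelMeans fun ν => leafTransport (superLaw root K A) c ν := by
  set P := superLaw root K A
  set N := levelSize n (L + 1) with hNdef
  have hN : 0 < N := levelSize_pos (L + 1) hn
  have hgm (j) := (measurable_ghostLeaf (n := n) (E := E) (L := L) j)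
  have hsel := measurable_selectedTree (n := n) (E := E) (L := L + 1)
  have hG (j) : Measurable fun ω : SuperSpace n (L + 1) E 𝒲 =>
      (ω.2, ω.1.1.leaves (ghostIndex ω.1.2 j)) := measurable_snd.prodMk ((hgm j).comp measurable_fst)
  have hS : Measurable fun ω : SuperSpace n (L + 1) E 𝒲 => (selectedTree ω.1.2 ω.1.1, ω.2) :=
    (hsel.comp measurable_fst).prodMk measurable_snd
  have hℓj (j) : Measurable fun p : SampleTree (Branch n) E (L + 1) × 𝒲 => ℓ p.2 (p.1.leaves j) :=
    hℓ.comp (measurable_snd.prodMk ((measurable_pi_apply j).comp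
      (measurable_leaves.comp measurable_fst)))
  have iG (j) : Integrable (fun ω : SuperSpace n (L + 1) E 𝒲 =>
      ℓ ω.2 (ω.1.1.leaves (ghostIndex ω.1.2 j))) P := by
    rw [← superLaw_map_hypothesis_ghost root K A j] at hint
    exact hint.comp_measurable (hG j)
  have iS (j) : Integrable (fun ω : SuperSpace n (L + 1) E 𝒲 =>
      ℓ ω.2 ((selectedTree ω.1.2 ω.1.1).leaves j)) P := by
    have := hintj j
    rw [← superLaw_map_selectedTree root K A] at this
    exact this.comp_measurable hS
  -- W is independent of the ghost leaf, so the loss there has the mean of the population risk.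
  have eG (j) : ∫ ω, ℓ ω.2 (ω.1.1.leaves (ghostIndex ω.1.2 j)) ∂P =
      ∫ p, populationRisk root K ℓ p.2 ∂(treeLaw (Branch n) root K (L + 1) ⊗ₘ A) := by
    have h1 : ∫ q, Function.uncurry ℓ q ∂P.map (fun ω => (ω.2, ω.1.1.leaves (ghostIndex ω.1.2 j))) =
        ∫ ω, ℓ ω.2 (ω.1.1.leaves (ghostIndex ω.1.2 j)) ∂P :=
      integral_map (hG j).aemeasurable hℓ.aestronglyMeasurable
    have h2 : ∫ w, populationRisk root K ℓ w ∂(treeLaw (Branch n) root K (L + 1) ⊗ₘ A).snd =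
        ∫ p, populationRisk root K ℓ p.2 ∂(treeLaw (Branch n) root K (L + 1) ⊗ₘ A) :=
      integral_map measurable_snd.aemeasurable (by
        rw [← Measure.snd, Measure.snd_compProd]
        exact hint.integral_prod_left.aestronglyMeasurable)
    rw [← h1, superLaw_map_hypothesis_ghost, integral_prod _ hint, ← h2, Measure.snd_compProd]
    rfl
  have iR : Integrable (fun p : SampleTree (Branch n) E (L + 1) × 𝒲 =>
      populationRisk root K ℓ p.2) (treeLaw (Branch n) root K (L + 1) ⊗ₘ A) := by
    have : Integrable (populationRisk root K ℓ) (treeLaw (Branch n) root K (L + 1) ⊗ₘ A).snd := by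
      rw [Measure.snd_compProd]; exact hint.integral_prod_left
    exact this.comp_measurable measurable_snd
  have eS (j) : ∫ p, ℓ p.2 (p.1.leaves j) ∂(treeLaw (Branch n) root K (L + 1) ⊗ₘ A) =
      ∫ ω, ℓ ω.2 ((selectedTree ω.1.2 ω.1.1).leaves j) ∂P := by
    rw [← superLaw_map_selectedTree root K A]
    exact integral_map hS.aemeasurable (hℓj j).aestronglyMeasurable
  set d : NodeIndex (Branch n) (L + 1) → ℝ := fun j => ∫ ω,
    (ℓ ω.2 (ω.1.1.leaves (ghostIndex ω.1.2 j)) - ℓ ω.2 ((selectedTree ω.1.2 ω.1.1).leaves j)) ∂P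
    with hd
  have hgen : genError root K A ℓ = (N : ℝ)⁻¹ * ∑ j, d j := by
    have hdj : ∀ j, d j =
        ∫ p, populationRisk root K ℓ p.2 ∂(treeLaw (Branch n) root K (L + 1) ⊗ₘ A) -
        ∫ p, ℓ p.2 (p.1.leaves j) ∂(treeLaw (Branch n) root K (L + 1) ⊗ₘ A) := fun j => by
      rw [hd]; simp only; rw [integral_sub (iG j) (iS j), eG, eS]
    have iE : Integrable (fun p : SampleTree (Branch n) E (L + 1) × 𝒲 =>
        empiricalRisk ℓ p.2 p.1) (treeLaw (Branch n) root K (L + 1) ⊗ₘ A) :=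
      (integrable_finsetSum _ fun j _ => hintj j).const_mul _
    rw [genError, integral_sub iR iE]
    simp only [empiricalRisk]
    rw [integral_const_mul, integral_finsetSum _ fun j _ => hintj j]
    simp_rw [hdj]
    rw [Finset.sum_sub_distrib, mul_sub, Finset.sum_const, Finset.card_univ, card_nodeIndex,
      nsmul_eq_mul, ← mul_assoc, inv_mul_cancel₀ (by exact_mod_cast hN.ne'), one_mul]
  have hdle : ∀ j, ENNReal.ofReal (d j) ≤ 2 * a * leafTransport P c (topNode j) := by
    intro j
    set jj : LeafBelow (topNode j) := ⟨j, rfl⟩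
    set G : (Bool → LeafBelow (topNode j) → E (L + 1)) × 𝒲 → ℝ :=
      fun q => ℓ q.2 (q.1 false jj) - ℓ q.2 (q.1 true jj) with hGdef
    have hGm : Measurable G :=
      (hℓ.comp (measurable_snd.prodMk (by fun_prop :
        Measurable fun q : (Bool → LeafBelow (topNode j) → E (L + 1)) × 𝒲 => q.1 false jj))).sub
      (hℓ.comp (measurable_snd.prodMk (by fun_prop :
        Measurable fun q : (Bool → LeafBelow (topNode j) → E (L + 1)) × 𝒲 => q.1 true jj)))
    have hdiff : ∀ ω : SuperSpace n (L + 1) E 𝒲,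
        ℓ ω.2 (ω.1.1.leaves (ghostIndex ω.1.2 j)) - ℓ ω.2 ((selectedTree ω.1.2 ω.1.1).leaves j) =
        boolSign (decision (topNode j) ω) * G (leafPair (topNode j) ω, hypothesis ω) := by
      intro ω
      have h1 : leafPair (topNode j) ω (decision (topNode j) ω) jj =
          (selectedTree ω.1.2 ω.1.1).leaves j := by
        simp only [leafPair, decision, Function.update_eq_self]
        rfl
      have h2 : leafPair (topNode j) ω (!decision (topNode j) ω) jj =
          ω.1.1.leaves (ghostIndex ω.1.2 j) := rfl
      rw [← h1, ← h2]
      cases decision (topNode j) ω <;> simp [boolSign, hGdef, hypothesis]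
    have hGi : Integrable (fun ω => G (leafPair (topNode j) ω, hypothesis ω)) P := by
      refine (integrable_norm_iff (hGm.comp ((measurable_leafPair _).prodMk
        measurable_hypothesis)).aestronglyMeasurable).1 ?_
      refine ((iG j).sub (iS j)).norm.congr (.of_forall fun ω => ?_)
      simp only [Pi.sub_apply]
      rw [hdiff, norm_mul, Real.norm_eq_abs, abs_boolSign, one_mul]
      rfl
    have h := (isFairGiven_leafPair root K A (topNode j)).ofReal_integral_le
      (measurable_decision _) (measurable_leafPair _) measurable_hypothesis (c := c)
      -- `G` is a difference of two losses, each of which contributes `a`.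
      (a := 2 * a) (ENNReal.mul_ne_top (by simp) ha) hGm hGi fun z w w' => by
        have e : G (z, w) - G (z, w') = (ℓ w (z false jj) - ℓ w' (z false jj)) -
            (ℓ w (z true jj) - ℓ w' (z true jj)) := by simp only [hGdef]; ring
        rw [e]
        refine (ENNReal.ofReal_le_ofReal (abs_sub _ _)).trans ?_
        rw [ENNReal.ofReal_add (abs_nonneg _) (abs_nonneg _), mul_assoc, two_mul]
        exact add_le_add (hc _ _ _) (hc _ _ _)
    rw [hd]
    simp only [hdiff]
    exact h
  calc ENNReal.ofReal (genError root K A ℓ)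
      = (N : ℝ≥0∞)⁻¹ * ENNReal.ofReal (∑ j, d j) := by
        rw [hgen, ENNReal.ofReal_mul (by positivity),
          ENNReal.ofReal_inv_of_pos (by exact_mod_cast hN), ENNReal.ofReal_natCast]
    _ ≤ (N : ℝ≥0∞)⁻¹ * ∑ j, ENNReal.ofReal (d j) := by
        gcongr
        exact Finset.le_sum_of_subadditive ENNReal.ofReal ENNReal.ofReal_zero.le
          (fun _ _ => ENNReal.ofReal_add_le) _ _
    _ ≤ (N : ℝ≥0∞)⁻¹ * ∑ j, 2 * a * leafTransport P c (topNode j) := by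
        gcongr with j
        exact hdle j
    _ = 2 * a * ((N : ℝ≥0∞)⁻¹ * ∑ j, leafTransport P c (topNode j)) := by
        rw [← Finset.mul_sum, mul_left_comm]
    _ ≤ _ := by
        rw [mean_leaves_eq_mean_level_one L hn]
        gcongr
        exact mean_level_one_le_sumOfLevelMeans L _

/-- At depth zero the only data point is the root, and a fresh leaf equals it. -/
theorem genError_zero (A : Kernel (SampleTree (Branch n) E 0) 𝒲) [IsMarkovKernel A]
    (ℓ : 𝒲 → E 0 → ℝ) (hℓ : Measurable (Function.uncurry ℓ)) : genError root K A ℓ = 0 := by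
  have hpr : ∀ w, populationRisk root K ℓ w = ℓ w root := fun w => by
    rw [populationRisk, chainLaw]
    exact integral_dirac' _ _ (hℓ.comp measurable_prodMk_left).stronglyMeasurable
  have hm : Measurable fun p : SampleTree (Branch n) E 0 × 𝒲 =>
      populationRisk root K ℓ p.2 - empiricalRisk ℓ p.2 p.1 := by
    simp only [hpr, empiricalRisk]
    refine (hℓ.comp (measurable_snd.prodMk measurable_const)).sub (Measurable.const_mul
      (Finset.measurable_sum _ fun j _ => hℓ.comp (measurable_snd.prodMk
        ((measurable_pi_apply j).comp (measurable_leaves.comp measurable_fst)))) _)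
  rw [genError, treeLaw, dirac_compProd, integral_map (by fun_prop) hm.aestronglyMeasurable]
  refine integral_eq_zero_of_ae (.of_forall fun w => ?_)
  change populationRisk root K ℓ w - empiricalRisk ℓ w _ = 0
  rw [hpr, empiricalRisk]
  simp [levelSize]
  exact sub_self _

theorem genError_le {L : ℕ} (A : Kernel (SampleTree (Branch n) E L) 𝒲) [IsMarkovKernel A]
    (hn : ∀ k < L, 0 < n k) (ℓ : 𝒲 → E L → ℝ) (hℓ : Measurable (Function.uncurry ℓ))
    (hint : Integrable (Function.uncurry ℓ)
      ((A ∘ₘ treeLaw (Branch n) root K L).prod (chainLaw root K L)))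
    (hintj : ∀ j, Integrable (fun p : SampleTree (Branch n) E L × 𝒲 => ℓ p.2 (p.1.leaves j))
      (treeLaw (Branch n) root K L ⊗ₘ A))
    {c : 𝒲 → 𝒲 → ℝ≥0∞} {a : ℝ≥0∞} (ha : a ≠ ∞)
    (hc : ∀ z w w', ENNReal.ofReal |ℓ w z - ℓ w' z| ≤ a * c w w') :
    ENNReal.ofReal (genError root K A ℓ) ≤
      2 * a * sumOfLevelMeans fun ν => leafTransport (superLaw root K A) c ν := by
  cases L with
  | zero => rw [genError_zero root K A ℓ hℓ]; simp
  | succ L => exact genError_le_succ root K A hn ℓ hℓ hint hintj ha hc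

end GenBound

/-! ### Markov chains -/

section Markov

variable {α β γ δ Ω : Type*} [MeasurableSpace α] [MeasurableSpace β] [MeasurableSpace γ]
  [MeasurableSpace δ] [MeasurableSpace Ω] [StandardBorelSpace γ] [Nonempty γ]
  {P : Measure Ω} [IsProbabilityMeasure P] {X : Ω → α} {V : Ω → β} {W : Ω → γ}

/-- A kernel that reads only V and reproduces the joint law is the conditional law given (X, V);
test functions that ignore X show that it is also the one given V. -/
theorem isMarkovChain_of_lintegral (hX : Measurable X) (hV : Measurable V) (hW : Measurable W)
    (κ : Kernel β γ) [IsMarkovKernel κ]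
    (h : ∀ f : (α × β) × γ → ℝ≥0∞, Measurable f →
      ∫⁻ ω, f ((X ω, V ω), W ω) ∂P = ∫⁻ ω, ∫⁻ w, f ((X ω, V ω), w) ∂κ (V ω) ∂P) :
    IsMarkovChain X V W P := by
  have hs : Measurable (Prod.snd : α × β → β) := measurable_snd
  have h1 : condDistrib W (fun ω => (X ω, V ω)) P =ᵐ[P.map fun ω => (X ω, V ω)]
      κ.comap Prod.snd hs := by
    refine condDistrib_ae_eq_of_measure_eq_compProd _ hW.aemeasurable
      (Measure.ext_of_lintegral _ fun f hf => ?_)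
    rw [lintegral_map hf (by fun_prop), Measure.lintegral_compProd hf,
      lintegral_map hf.lintegral_kernel_prod_right' (by fun_prop), h f hf]
    rfl
  have h2 : condDistrib W V P =ᵐ[P.map V] κ := by
    refine condDistrib_ae_eq_of_measure_eq_compProd _ hW.aemeasurable
      (Measure.ext_of_lintegral _ fun f hf => ?_)
    rw [lintegral_map hf (by fun_prop), Measure.lintegral_compProd hf,
      lintegral_map hf.lintegral_kernel_prod_right' (by fun_prop)]
    exact h (fun q => f (q.1.2, q.2)) (by fun_prop)
  filter_upwards [ae_of_ae_map (hX.prodMk hV).aemeasurable h1, ae_of_ae_map hV.aemeasurable h2]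
    with ω hω1 hω2
  rw [hω1, hω2, Kernel.comap_apply]

theorem isMarkovChain_of_comp {g : β → α} (hg : Measurable g) (hV : Measurable V)
    (hW : Measurable W) : IsMarkovChain (fun ω => g (V ω)) V W P := by
  refine isMarkovChain_of_lintegral (hg.comp hV) hV hW (condDistrib W V P) fun f hf => ?_
  have hf' : Measurable fun q : β × γ => f ((g q.1, q.1), q.2) := by fun_prop
  rw [← lintegral_map (f := fun q : β × γ => f ((g q.1, q.1), q.2)) (g := fun ω => (V ω, W ω)) hf'
    (by fun_prop), ← compProd_map_condDistrib hW.aemeasurable, Measure.lintegral_compProd hf',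
    lintegral_map hf'.lintegral_kernel_prod_right' hV]

/-- If `W` is sampled from `(V, R)`, where `R` is independent of `(X, V)`, then `X - V - W` is a
Markov chain. -/
theorem isMarkovChain_of_indep {ε : Type*} [MeasurableSpace ε] {μ : Measure Ω}
    [IsProbabilityMeasure μ]
    (B : Kernel Ω γ) [IsMarkovKernel B] {R : Ω → δ} (hX : Measurable X) (hV : Measurable V)
    (hR : Measurable R)
    (hind : μ.map (fun ω => ((X ω, V ω), R ω)) = (μ.map fun ω => (X ω, V ω)).prod (μ.map R))
    (A : Kernel ε γ) [IsMarkovKernel A] {g : β × δ → ε} (hg : Measurable g)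
    (hB : ∀ ω, B ω = A (g (V ω, R ω))) :
    IsMarkovChain (fun q : Ω × γ => X q.1) (fun q => V q.1) (fun q => q.2) (μ ⊗ₘ B) := by
  have hP := Measure.isProbabilityMeasure_map (μ := μ) hR.aemeasurable
  have hgr : ∀ v, Measurable fun r => g (v, r) := fun v => hg.comp measurable_prodMk_left
  -- Draw a fresh copy of R from its marginal law, then W from `A`. By independence this is the law
  -- of W given V, with or without X.
  let κ : Kernel β γ := A ∘ₖ ((Kernel.id ×ₖ Kernel.const β (μ.map R)).map g)
  have hκm : IsMarkovKernel ((Kernel.id ×ₖ Kernel.const β (μ.map R)).map g) :=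
    Kernel.IsMarkovKernel.map _ hg
  have hκ : IsMarkovKernel κ := by infer_instance
  have hκl : ∀ v (h : γ → ℝ≥0∞), Measurable h →
      ∫⁻ w, h w ∂κ v = ∫⁻ ω, ∫⁻ w, h w ∂A (g (v, R ω)) ∂μ := by
    intro v h hh
    have hA : Measurable fun e => ∫⁻ w, h w ∂A e := hh.lintegral_kernel
    rw [Kernel.lintegral_comp _ _ _ hh, Kernel.map_apply _ hg, lintegral_map hA hg,
      Kernel.prod_apply, Kernel.id_apply, Kernel.const_apply,
      lintegral_prod (fun q => ∫⁻ w, h w ∂A (g q)) (hA.comp hg).aemeasurable,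
      lintegral_dirac' v (f := fun x => ∫⁻ y, ∫⁻ w, h w ∂A (g (x, y)) ∂μ.map R)
        (Measurable.lintegral_prod_right' (f := fun q => ∫⁻ w, h w ∂A (g q)) (hA.comp hg)),
      lintegral_map (f := fun r => ∫⁻ w, h w ∂A (g (v, r))) (hA.comp (hgr v)) hR]
  refine isMarkovChain_of_lintegral (hX.comp measurable_fst) (hV.comp measurable_fst)
    measurable_snd κ fun f hf => ?_
  have hXV : Measurable fun ω => (X ω, V ω) := hX.prodMk hV
  have hFm : Measurable fun q : (α × β) × δ => ∫⁻ w, f (q.1, w) ∂A (g (q.1.2, q.2)) :=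
    Measurable.lintegral_kernel_prod_right' (κ := A.comap (fun q : (α × β) × δ => g (q.1.2, q.2))
      (by fun_prop)) (f := fun q => f (q.1.1, q.2)) (by fun_prop)
  have hKm : Measurable fun ω => ∫⁻ w, f ((X ω, V ω), w) ∂κ (V ω) :=
    Measurable.lintegral_kernel_prod_right' (κ := κ.comap V hV)
      (f := fun q => f ((X q.1, V q.1), q.2)) (by fun_prop)
  have hKm' : Measurable fun q : Ω × γ => ∫⁻ w, f ((X q.1, V q.1), w) ∂κ (V q.1) :=
    hKm.comp measurable_fst
  rw [Measure.lintegral_compProd (f := fun q : Ω × γ => f ((X q.1, V q.1), q.2)) (by fun_prop),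
    Measure.lintegral_compProd hKm']
  simp only [lintegral_const, measure_univ, mul_one, hB]
  have e : ∫⁻ ω, ∫⁻ w, f ((X ω, V ω), w) ∂A (g (V ω, R ω)) ∂μ =
      ∫⁻ q, ∫⁻ w, f (q.1, w) ∂A (g (q.1.2, q.2)) ∂μ.map fun ω => ((X ω, V ω), R ω) :=
    (lintegral_map hFm (hXV.prodMk hR)).symm
  rw [e, hind, lintegral_prod _ hFm.aemeasurable, lintegral_map hFm.lintegral_prod_right' hXV]
  refine lintegral_congr fun ω => ?_
  rw [hκl _ (fun w => f ((X ω, V ω), w)) (hf.comp measurable_prodMk_left)]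
  exact lintegral_map (f := fun r => ∫⁻ w, f ((X ω, V ω), w) ∂A (g (V ω, r)))
    (show Measurable ((fun q : (α × β) × δ => ∫⁻ w, f (q.1, w) ∂A (g (q.1.2, q.2))) ∘
      Prod.mk (X ω, V ω)) from hFm.comp measurable_prodMk_left) hR

end Markov

/-! ### The Markov chain at the last and at the first level -/

section NodeMarkov

variable {n : ℕ → ℕ} {L : ℕ} {E : ℕ → Type u} [∀ l, MeasurableSpace (E l)] {𝒲 : Type v}
  [MeasurableSpace 𝒲] [StandardBorelSpace 𝒲] [Nonempty 𝒲]
  (root : E 0) (K : ∀ l, Kernel (E l) (E (l + 1))) [∀ l, IsMarkovKernel (K l)]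
  (A : Kernel (SampleTree (Branch n) E L) 𝒲) [IsMarkovKernel A]

/-- The copies of a node of the last level are themselves leaves, so X is a function of Y; the
algorithm plays no role. -/
theorem nodeMarkov_last (ν : ProperNode n L) (hν : (ν.1 : ℕ) + 1 = L) :
    NodeMarkov (superLaw root K A) ν := by
  obtain ⟨⟨l, hl⟩, i⟩ := ν
  obtain rfl : l + 1 = L := hν
  exact isMarkovChain_of_comp (P := superLaw root K A)
    (V := fun ω => (leafPair ⟨⟨l, hl⟩, i⟩ ω, decision ⟨⟨l, hl⟩, i⟩ ω))
    (g := fun v : (Bool → LeafBelow (⟨⟨l, hl⟩, i⟩ : ProperNode n (l + 1)) → E (l + 1)) × Bool =>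
      fun b => v.1 b ⟨i, rfl⟩)
    (measurable_pi_iff.2 fun b => by fun_prop)
    ((measurable_leafPair _).prodMk (measurable_decision _)) measurable_hypothesis

open Classical in
/-- The decisions at the nodes below the child `i` of the root are those of the first component,
the other ones are those of the second component. -/
noncomputable def mergeDecisions (i : Fin (n 0)) (U : Decisions n L × Decisions n L) :
    Decisions n L :=
  fun ν => if ν.2 ⟨0, Nat.succ_pos _⟩ = i then U.1 ν else U.2 ν

/-- Merging of supersamples with decisions. -/
noncomputable def mergeBase (i : Fin (n 0))
    (q : (SampleTree (Doubled n) E L × Decisions n L) ×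
      (SampleTree (Doubled n) E L × Decisions n L)) :
    SampleTree (Doubled n) E L × Decisions n L :=
  (SampleTree.merge {c | c.1 = i} (q.1.1, q.2.1), mergeDecisions i (q.1.2, q.2.2))

theorem measurable_mergeBase (i : Fin (n 0)) :
    Measurable (mergeBase i : _ → SampleTree (Doubled n) E L × Decisions n L) :=
  ((SampleTree.measurable_merge (C := Doubled n) _).comp (by fun_prop)).prodMk
    ((measurable_of_finite (mergeDecisions i)).comp (by fun_prop))

/-- Both copies of the child `i` are grafted together with all decisions below `i`, so that
selection inside and outside the branch reads separate samples. -/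
theorem baseLaw_prod_map_mergeBase (i : Fin (n 0)) :
    ((baseLaw root K n L).prod (baseLaw root K n L)).map (mergeBase i) = baseLaw root K n L := by
  have hT := treeLaw_prod_map_merge (C := Doubled n) root K {c | c.1 = i} L
  have hU : ((decisionLaw n L).prod (decisionLaw n L)).map (mergeDecisions i) =
      decisionLaw n L := by
    have h := pi_prod_map_merge (fun ν : ProperNode n L => ν.2 ⟨0, Nat.succ_pos _⟩ = i)
      (fun _ => fairCoin) (fun _ => fairCoin)
    simp only [ite_self] at h
    convert h using 2
    funext x ν
    simp only [mergeDecisions]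
  have hmT := SampleTree.measurable_merge (C := Doubled n) (E := E) (L := L) {c | c.1 = i}
  have h := compProd_map_prodMap ((treeLaw (Doubled n) root K L).prod (treeLaw (Doubled n) root K L))
    (Kernel.const _ (decisionLaw n L) ∥ₖ Kernel.const _ (decisionLaw n L)) hmT
    (measurable_of_finite (mergeDecisions i)) (Kernel.const _ (decisionLaw n L)) (fun a => by
      rw [Kernel.parallelComp_apply, Kernel.const_apply, Kernel.const_apply, hU,
        Kernel.const_apply])
  rw [hT] at h
  have hb : baseLaw root K n L =
      treeLaw (Doubled n) root K L ⊗ₘ Kernel.const _ (decisionLaw n L) :=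
    Measure.compProd_const.symm
  rw [hb, compProd_prod_compProd, Measure.map_map (measurable_mergeBase i) (by fun_prop), ← h]
  rfl

/-- Extend the leaves to a tree. -/
def SampleTree.ofLeaves {C : ℕ → Type} (t : SampleTree C E L)
    (r : NodeIndex C (L + 1) → E (L + 1)) : SampleTree C E (L + 1) :=
  SampleTree.extend (t, r)

theorem SampleTree.leaves_ofLeaves {C : ℕ → Type} [∀ k, Fintype (C k)] (t : SampleTree C E L)
    (r : NodeIndex C (L + 1) → E (L + 1)) : (SampleTree.ofLeaves t r).leaves = r :=
  SampleTree.extend_last (t, r)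

theorem SampleTree.measurable_ofLeaves {C : ℕ → Type} [∀ k, Fintype (C k)] (t : SampleTree C E L) :
    Measurable (SampleTree.ofLeaves t) :=
  SampleTree.measurable_extend.comp measurable_prodMk_left

theorem selectedTree_merge_of_eq (i : Fin (n 0)) (U : Decisions n L × Decisions n L)
    (T : SampleTree (Doubled n) E L × SampleTree (Doubled n) E L) (l : Fin (L + 1))
    (h0 : 0 < (l : ℕ)) (j : NodeIndex (Branch n) l) (hj : j ⟨0, h0⟩ = i) :
    selectedTree (mergeDecisions i U) (SampleTree.merge {c | c.1 = i} T) l j =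
      selectedTree U.1 T.1 l j := by
  refine (if_pos ⟨h0, hj⟩).trans (congrArg (T.1 l) ?_)
  funext k
  exact Prod.ext rfl (if_pos hj)

theorem selectedTree_merge_of_ne (i : Fin (n 0)) (U : Decisions n L × Decisions n L)
    (T : SampleTree (Doubled n) E L × SampleTree (Doubled n) E L) (l : Fin (L + 1))
    (h0 : 0 < (l : ℕ)) (j : NodeIndex (Branch n) l) (hj : j ⟨0, h0⟩ ≠ i) :
    selectedTree (mergeDecisions i U) (SampleTree.merge {c | c.1 = i} T) l j =
      selectedTree U.2 T.2 l j := by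
  refine (if_neg fun ⟨_, h⟩ => hj h).trans (congrArg (T.2 l) ?_)
  funext k
  exact Prod.ext rfl (if_neg hj)

theorem update_mergeDecisions (i : Fin (n 0)) (U : Decisions n L × Decisions n L)
    (ν : ProperNode n L) (hν : ν.2 ⟨0, Nat.succ_pos _⟩ = i) (b : Bool) :
    Function.update (mergeDecisions i U) ν b =
      mergeDecisions i (Function.update U.1 ν b, U.2) := by
  funext ν'
  by_cases h : ν' = ν
  · subst h
    rw [Function.update_self]
    exact ((if_pos hν).trans (Function.update_self ν' b U.1)).symm
  · simp [mergeDecisions, h]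

/-- The selected leaves below ν are determined by (Y, U), and the other selected leaves are
independent of (X, Y, U). -/
theorem nodeMarkov_first (hA : UsesOnlyLeaves A) (ν : ProperNode n L) (hν : (ν.1 : ℕ) = 0) :
    NodeMarkov (superLaw root K A) ν := by
  obtain ⟨⟨l, hl⟩, i⟩ := ν
  obtain rfl : l = 0 := hν
  obtain _ | L := L
  · exact absurd hl (lt_irrefl 0)
  set ν : ProperNode n (L + 1) := ⟨⟨0, hl⟩, i⟩ with hνdef
  obtain ⟨A', hA'⟩ := hA
  -- An arbitrary tree supplies the upper levels above given leaves. Applying `A` to the completed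
  -- tree gives a Markov kernel on leaves, whereas `A'` is not assumed to be Markov.
  obtain ⟨t⟩ := nonempty_of_isProbabilityMeasure (treeLaw (Branch n) root K L)
  let Base := SampleTree (Doubled n) E (L + 1) × Decisions n (L + 1)
  let X : Base → Bool → E (0 + 1) := fun q b =>
    selectedTree (Function.update q.2 ν b) q.1 ν.1.succ ν.2
  let V : Base → (Bool → LeafBelow ν → E (L + 1)) × Bool := fun q =>
    (fun b (j : LeafBelow ν) => (selectedTree (Function.update q.2 ν b) q.1).leaves j.1, q.2 ν)
  let R : Base → {j : NodeIndex (Branch n) (L + 1) // ¬ j.ancestor ν.1.2 = ν.2} → E (L + 1) :=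
    fun q j => (selectedTree q.2 q.1).leaves j.1
  classical
  let g : ((Bool → LeafBelow ν → E (L + 1)) × Bool) ×
      ({j : NodeIndex (Branch n) (L + 1) // ¬ j.ancestor ν.1.2 = ν.2} → E (L + 1)) →
      NodeIndex (Branch n) (L + 1) → E (L + 1) := fun p j =>
    if h : j.ancestor ν.1.2 = ν.2 then p.1.1 p.1.2 ⟨j, h⟩ else p.2 ⟨j, h⟩
  have hX : Measurable X := measurable_pi_iff.2 fun b => (measurable_pi_apply ν.2).comp
    ((measurable_pi_apply ν.1.succ).comp (measurable_selectedTree_update ν b))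
  have hV : Measurable V := (measurable_pi_iff.2 fun b => measurable_pi_iff.2 fun (j : LeafBelow ν) =>
    (measurable_pi_apply j.1).comp (measurable_leaves.comp
      (measurable_selectedTree_update ν b))).prodMk ((measurable_pi_apply ν).comp measurable_snd)
  have hR : Measurable R := measurable_pi_iff.2 fun j => (measurable_pi_apply j.1).comp
    (measurable_leaves.comp measurable_selectedTree)
  have hg : Measurable g := by
    refine measurable_pi_iff.2 fun j => ?_
    by_cases h : j.ancestor ν.1.2 = ν.2
    · simp only [g, h, dif_pos]
      have : Measurable fun q : (Bool → LeafBelow ν → E (L + 1)) × Bool => q.1 q.2 ⟨j, h⟩ :=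
        measurable_from_prod_countable_left fun u => by fun_prop
      exact this.comp measurable_fst
    · simp only [g, h, dif_neg, not_false_eq_true]
      fun_prop
  have hanc : ∀ j : NodeIndex (Branch n) (L + 1),
      j.ancestor ν.1.2 = ν.2 ↔ j ⟨0, L.succ_pos⟩ = i ⟨0, Nat.one_pos⟩ := by
    refine fun j => ⟨fun h => congrFun h ⟨0, Nat.one_pos⟩, fun h => ?_⟩
    funext k
    obtain rfl : k = ⟨0, Nat.one_pos⟩ := Fin.eq_zero k
    exact h
  have hXm : ∀ q, X (mergeBase (i ⟨0, Nat.one_pos⟩) q) = X q.1 := by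
    intro q
    funext b
    simp only [X, mergeBase]
    rw [update_mergeDecisions _ _ ν rfl]
    exact selectedTree_merge_of_eq (i ⟨0, Nat.one_pos⟩) (Function.update q.1.2 ν b, q.2.2)
      (q.1.1, q.2.1) ν.1.succ Nat.one_pos ν.2 rfl
  have hVm : ∀ q, V (mergeBase (i ⟨0, Nat.one_pos⟩) q) = V q.1 := by
    intro q
    refine Prod.ext ?_ (if_pos rfl)
    funext b j
    simp only [V, mergeBase]
    rw [update_mergeDecisions _ _ ν rfl]
    exact selectedTree_merge_of_eq (i ⟨0, Nat.one_pos⟩) (Function.update q.1.2 ν b, q.2.2)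
      (q.1.1, q.2.1) (Fin.last (L + 1)) L.succ_pos j.1 ((hanc _).1 j.2)
  have hRm : ∀ q, R (mergeBase (i ⟨0, Nat.one_pos⟩) q) = R q.2 := by
    intro q
    funext j
    exact selectedTree_merge_of_ne (i ⟨0, Nat.one_pos⟩) (q.1.2, q.2.2)
      (q.1.1, q.2.1) (Fin.last (L + 1)) L.succ_pos j.1 fun h => j.2 ((hanc _).2 h)
  -- In a merged pair of independent samples, `X` and `V` read the first sample and `R` the second.
  have hind : (baseLaw root K n (L + 1)).map (fun q => ((X q, V q), R q)) =
      ((baseLaw root K n (L + 1)).map fun q => (X q, V q)).prod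
        ((baseLaw root K n (L + 1)).map R) := by
    conv_lhs => rw [← baseLaw_prod_map_mergeBase root K (i ⟨0, Nat.one_pos⟩)]
    rw [Measure.map_map ((hX.prodMk hV).prodMk hR) (measurable_mergeBase _),
      Measure.map_prod_map _ _ (hX.prodMk hV) hR]
    congr 1
    funext q
    simp only [Function.comp, hXm, hVm, hRm]
    rfl
  refine isMarkovChain_of_indep (μ := baseLaw root K n (L + 1))
    (A.comap (fun p => selectedTree p.2 p.1) measurable_selectedTree) hX hV hR hind
    (A.comap (SampleTree.ofLeaves t) (SampleTree.measurable_ofLeaves t)) hg fun q => ?_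
  rw [Kernel.comap_apply, Kernel.comap_apply, hA', hA', SampleTree.leaves_ofLeaves]
  congr 1
  funext j
  simp only [g, V, R]
  split_ifs with h
  · rw [Function.update_eq_self]
  · rfl

end NodeMarkov

/-! ### The main theorem -/

theorem sumOfLevelMeans_mono {n : ℕ → ℕ} {L : ℕ} {f g : ProperNode n L → ℝ≥0∞}
    (h : ∀ ν, f ν ≤ g ν) : sumOfLevelMeans f ≤ sumOfLevelMeans g := by
  unfold sumOfLevelMeans
  gcongr with l _ i _
  exact h _

theorem mainTheorem7 {E : ℕ → Type u} [∀ l, MeasurableSpace (E l)]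
    {𝒲 : Type v} [MeasurableSpace 𝒲] [StandardBorelSpace 𝒲] [Nonempty 𝒲]
    (L : ℕ) [StandardBorelSpace (E L)] [Nonempty (E L)]
    (n : ℕ → ℕ) (hn : ∀ k < L, 0 < n k)
    (root : E 0) (K : ∀ l, Kernel (E l) (E (l + 1))) [∀ l, IsMarkovKernel (K l)]
    (A : Kernel (SampleTree (Branch n) E L) 𝒲) [IsMarkovKernel A] :
    -- the Wasserstein bound for Lipschitz losses
    (∀ [MetricSpace 𝒲] (ℓ : 𝒲 → E L → ℝ) (Λ : ℝ≥0),
      Measurable (fun p : 𝒲 × 𝒲 => dist p.1 p.2) →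
      Measurable (Function.uncurry ℓ) →
      (∀ z, LipschitzWith Λ fun w => ℓ w z) →
      Integrable (Function.uncurry ℓ)
        ((A ∘ₘ treeLaw (Branch n) root K L).prod (chainLaw root K L)) →
      (∀ j, Integrable (fun p : SampleTree (Branch n) E L × 𝒲 => ℓ p.2 (p.1.leaves j))
        (treeLaw (Branch n) root K L ⊗ₘ A)) →
      ENNReal.ofReal (genError root K A ℓ) ≤
        2 * Λ * sumOfLevelMeans fun ν => leafTransport (superLaw root K A) edist ν) ∧
    -- its relaxation for bounded losses
    (∀ ℓ : 𝒲 → E L → ℝ, Measurable (Function.uncurry ℓ) → (∀ w z, ℓ w z ∈ Set.Icc 0 1) →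
      ENNReal.ofReal (genError root K A ℓ) ≤
        2 * sumOfLevelMeans fun ν => leafTransport (superLaw root K A) discreteDist ν) ∧
    (∀ ν, 2 * leafTransport (superLaw root K A) discreteDist ν ≤
      leafSqrtInfo (superLaw root K A) ν) ∧
    (∀ ν, leafSqrtInfo (superLaw root K A) ν ≤
      (2 * leafInfo (superLaw root K A) ν) ^ (1 / 2 : ℝ)) ∧
    -- comparison of the two conditional mutual informations, with the exact gap
    (∀ ν, NodeMarkov (superLaw root K A) ν →
      nodeInfo (superLaw root K A) ν ≤ leafInfo (superLaw root K A) ν ∧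
      leafInfo (superLaw root K A) ν ≠ ∞ ∧
      leafInfo (superLaw root K A) ν - nodeInfo (superLaw root K A) ν =
        condMutualInfo (decision ν) (leafPair ν) (fun ω => (nodePair ν ω, hypothesis ω))
          (superLaw root K A)) ∧
    -- comparison of the two bounds
    ((∀ ν, NodeMarkov (superLaw root K A) ν) →
      (sumOfLevelMeans fun ν => nodeSqrtInfo (superLaw root K A) ν) ≤
        (sumOfLevelMeans fun ν => (2 * nodeInfo (superLaw root K A) ν) ^ (1 / 2 : ℝ)) ∧
      (sumOfLevelMeans fun ν => (2 * nodeInfo (superLaw root K A) ν) ^ (1 / 2 : ℝ)) ≤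
        (sumOfLevelMeans fun ν => (2 * leafInfo (superLaw root K A) ν) ^ (1 / 2 : ℝ))) ∧
    -- the Markov chain holds at the first and the last level if only data points are used
    (UsesOnlyLeaves A → ∀ ν : ProperNode n L, (ν.1 : ℕ) = 0 ∨ (ν.1 : ℕ) + 1 = L →
      NodeMarkov (superLaw root K A) ν) := by
  have hM : ∀ ν, NodeMarkov (superLaw root K A) ν →
      nodeInfo (superLaw root K A) ν ≤ leafInfo (superLaw root K A) ν ∧
      leafInfo (superLaw root K A) ν ≠ ∞ ∧
      leafInfo (superLaw root K A) ν - nodeInfo (superLaw root K A) ν =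
        condMutualInfo (decision ν) (leafPair ν) (fun ω => (nodePair ν ω, hypothesis ω))
          (superLaw root K A) := fun ν hν =>
    IsMarkovChain.condMutualInfo_sub hν (isFairGiven_pairs root K A ν) (measurable_nodePair ν)
      (measurable_decision ν) (measurable_leafPair ν) measurable_hypothesis
  refine ⟨?_, ?_, fun ν => ?_, fun ν => ?_, hM, fun h => ⟨?_, ?_⟩, ?_⟩
  · intro _ ℓ Λ _ hℓ hΛ hint hintj
    refine genError_le root K A hn ℓ hℓ hint hintj ENNReal.coe_ne_top fun z w w' => ?_
    rw [← Real.dist_eq, ← edist_dist]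
    exact hΛ z w w'
  · intro ℓ hℓ hb
    -- A loss with values in [0, 1] is integrable, and 1-Lipschitz for the discrete metric.
    have h := genError_le root K A hn ℓ hℓ
      (.of_bound hℓ.aestronglyMeasurable 1 (.of_forall fun p => abs_le.2
        ⟨by have := (hb p.1 p.2).1; simp only [Function.uncurry]; linarith, (hb p.1 p.2).2⟩))
      (fun j => .of_bound (hℓ.comp (measurable_snd.prodMk ((measurable_pi_apply j).comp
        (measurable_leaves.comp measurable_fst)))).aestronglyMeasurable 1
        (.of_forall fun p => abs_le.2 ⟨by have := (hb p.2 (p.1.leaves j)).1; linarith,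
          (hb p.2 (p.1.leaves j)).2⟩)) ENNReal.one_ne_top (c := discreteDist) fun z w w' => by
        rw [one_mul, discreteDist]
        split_ifs with hw
        · simp [hw]
        · rw [ENNReal.ofReal_le_one, abs_le]
          constructor <;> linarith [(hb w z).1, (hb w z).2, (hb w' z).1, (hb w' z).2]
    rwa [mul_one] at h
  · exact (isFairGiven_leafPair root K A ν).two_mul_lintegral_transportCost_le
      (measurable_decision ν) (measurable_leafPair ν) measurable_hypothesis
  · exact lintegral_sqrt_condMutualInfoAt_le measurable_hypothesis (measurable_decision ν)
      (measurable_leafPair ν)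
  · exact sumOfLevelMeans_mono fun ν => lintegral_sqrt_condMutualInfoAt_le measurable_hypothesis
      (measurable_decision ν) (measurable_nodePair ν)
  · refine sumOfLevelMeans_mono fun ν => ENNReal.rpow_le_rpow ?_ (by norm_num)
    gcongr
    exact (hM ν (h ν)).1
  · rintro hA ν (hν | hν)
    · exact nodeMarkov_first root K A hA ν hν
    · exact nodeMarkov_last root K A ν hν
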